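/- **Setting.** Let $d\ge 1$, let $\kappa$ be a bounded Borel probability density on $\mathbb R^d$ that vanishes outside a compact set $A\subset\mathbb R^d$, and for $\lambda>0$ let $\mathcal P_\lambda$ be a Poisson point process on $\mathbb R^d$ with intensity measure $\lambda\kappa(x)\,dx$, all defined on one probability space. Let $\xi(x;\mathcal X)\in[0,\infty)$ be a measurable function of a finite set $\mathcal X\subset\mathbb R^d$ and a point $x\in\mathcal X$; for $x\notin\mathcal X$ put $\xi(x;\mathcal X):=\xi(x;\mathcal X\cup\{x\})$. Put $\xi_\lambda(x;\mathcal X):=\xi(x;x+\lambda^{1/d}(-x+\mathcal X))$ and $$\mu^\xi_\lambda:=\sum_{x\in\mathcal P_\lambda\cap A}\xi_\lambda(x;\mathcal P_\lambda)\,\delta_x .$$ Write $B_r(x)$ for the closed Euclidean ball. Assume: * $\xi$ is exponentially stabilizing: for all $\lambda\ge1$, $x\in A$ there is an almost surely finite random variable $R(x,\lambda)$ such that almost surely, with $B:=B_{\lambda^{-1/d}R(x,\lambda)}(x)$, $\xi_\lambda(x;(\mathcal P_\lambda\cap B)\cup\mathcal X)=\xi_\lambda(x;\mathcal P_\lambda\cap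 B)$ for all finite $\mathcal X\subset A\setminus B$, and $\limsup_{t\to\infty}t^{-1}\log\big(\sup_{\lambda\ge1,x\in A}\mathbb P[R(x,\lambda)>t]\big)<0$; * $\xi$ has a moment of some order $p>2$: $\sup_{\lambda\ge1,x\in A}\mathbb E[\xi_\lambda(x;\mathcal P_\lambda)^p]<\infty$. Let $\Gamma_1,\dots,\Gamma_m\subset A$ be Borel sets of positive Lebesgue measure such that, as $r\downarrow0$, the set of points at $\ell_\infty$-distance at most $r$ from $\partial\Gamma_i$ has Lebesgue measure $O(r)$. Let $f_i:\Gamma_i\to\mathbb R$ be bounded and Borel, and put $T_i:=\int_{\Gamma_i}f_i\,d\mu^\xi_\lambda$. **Nondegeneracy.** For Borel $B\subset A$ and bounded Borel $f$ on $B$, let $Q_w$ be the closed unit cube centred at $w\in\mathbb Z^d$, let $\mathcal W_\lambda(B):=\{w\in\mathbb Z^d:Q_w\subseteq\lambda^{1/d}B\}$, and for $w\in\mathcal W_\lambda(B)$ let $$F_w:=\sum_{x\in\mathcal P_\lambda\cap\lambda^{-1/d}Q_w}\xi_\lambda(x;\mathcal P_\lambda)f(x).$$ The measure $\mu^\xi_\lambda$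 is *nondegenerate on* $(B,f)$ if there are constants $\rho,\eta>0$ such that for all sufficiently large $\lambda$ there are events $A_w$, $w\in\mathcal W_\lambda(B)$, in the $\sigma$-field generated by $\mathcal P_\lambda$, with $\mathbb P(A_w)\ge\rho$ for all $w$, for which the following holds. Let $J:=\{w\in\mathcal W_\lambda(B):A_w\text{ occurs}\}$ and let $\mathcal G_\lambda$ be the $\sigma$-field generated by the random set $J$ and the values of $F_w$ for $w\notin J$. Then 1. for every $w$, almost surely on $\{w\in J\}$, $\mathrm{Var}[F_w\mid\mathcal G_\lambda]>\eta$; 2. for all $w\ne v$, $F_w$ and $F_v$ are conditionally independent given $\mathcal G_\lambda$ on the event $\{w,v\in J\}$, i.e. for all Borel $S,S'\subset\mathbb R$, almost surely on that event, $\mathbb P[F_w\in S,F_v\in S'\mid\mathcal G_\lambda]=\mathbb P[F_w\in S\mid\mathcal G_\lambda]\,\mathbb P[F_v\in S'\mid\mathcal G_\lambda]$. **Lemma.** For each $i$: if $\mu^\xi_\lambda$ is nondegenerate on $(\Gamma_i,f_i)$, then there is a constant $C_i\in(0,\infty)$ such that, for all sufficiently large $\lambda$, $T_i$ is square integrable and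 $\mathrm{Var}[T_i]\ge C_i\lambda$. -/

import Mathlib

open MeasureTheory ProbabilityTheory Set Filter Topology
open scoped ENNReal NNReal Pointwise

noncomputable section

namespace GeomCLT

/-- Finite point configurations in `ℝ^d`. Points of `ℝ^d` are functions `Fin d → ℝ`, whose norm in
Mathlib is the `ℓ_∞` norm; the Euclidean norm is written out where it is needed. -/
abbrev Config (d : ℕ) : Type := Finset (Fin d → ℝ)

open Classical in
/-- The part `X ∩ B` of a configuration lying in the set `B`. -/
def restr {d : ℕ} (X : Config d) (B : Set (Fin d → ℝ)) : Config d := X.filter (fun x => x ∈ B)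

/-- The standard σ-algebra on configurations: the one generated by the counting maps
`X ↦ card (X ∩ B)`, `B` Borel. (It differs from the instance that Mathlib puts on `Finset`, which
only uses one-point sets `B`, so it is always named explicitly.) -/
@[reducible] def configSigma (d : ℕ) : MeasurableSpace (Config d) :=
  ⨆ (B : Set (Fin d → ℝ)) (_ : MeasurableSet B),
    MeasurableSpace.comap (fun X : Config d => (restr X B).card) ⊤

/-- `N` is a Poisson point process on `ℝ^d` with (finite) intensity measure `m`. -/
structure IsPoissonProcess {Ω : Type*} [MeasurableSpace Ω] {d : ℕ} (N : Ω → Config d)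
    (m : Measure (Fin d → ℝ)) (P : Measure Ω) : Prop where
  measurable : Measurable[_, configSigma d] N
  intensity_finite : m univ < ∞
  law : ∀ B : Set (Fin d → ℝ), MeasurableSet B →
    P.map (fun ω => (restr (N ω) B).card) = poissonMeasure (m B).toNNReal
  indep : ∀ (n : ℕ) (B : Fin n → Set (Fin d → ℝ)), (∀ i, MeasurableSet (B i)) →
    Pairwise (fun i j => Disjoint (B i) (B j)) →
    iIndepFun (fun i ω => (restr (N ω) (B i)).card) P

/-- The scaling factor `lam ^ (1/d)`. -/
def scale (d : ℕ) (lam : ℝ) : ℝ := lam ^ ((1 : ℝ) / (d : ℝ))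

/-- The functional `ξ` is measurable on the pairs `(x, X)` with `x ∈ X`. (The value at a pair with
`x ∉ X` is by convention the one at `(x, X ∪ {x})`, so measurability is asked of that.) -/
def MeasurableFunctional {d : ℕ} (ξ : (Fin d → ℝ) → Config d → ℝ≥0) : Prop :=
  Measurable[MeasurableSpace.prod inferInstance (configSigma d)]
    (fun q : (Fin d → ℝ) × Config d => ξ q.1 (insert q.1 q.2))

/-- `ξ_lam (x; X) = ξ (x; x + lam ^ (1/d) (-x + X))`, where `X` is replaced by `X ∪ {x}` if
`x ∉ X`. -/
def scaled {d : ℕ} (ξ : (Fin d → ℝ) → Config d → ℝ≥0) (lam : ℝ) (x : Fin d → ℝ) (X : Config d) :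
    ℝ≥0 :=
  ξ x ((insert x X).image (fun y => x + scale d lam • (-x + y)))

/-- The closed Euclidean ball of radius `r` centred at `x`. -/
def euclBall {d : ℕ} (x : Fin d → ℝ) (r : ℝ) : Set (Fin d → ℝ) :=
  {y | ‖WithLp.toLp 2 (y - x)‖ ≤ r}

/-- Exponential stabilization of `ξ` with respect to the Poisson processes `N lam` and the set `A`:
radii of stabilization `R lam x` exist whose tails, uniformly in `lam ≥ 1` and `x ∈ A`, satisfy
`limsup_{t → ∞} t⁻¹ log (sup P [R > t]) < 0` (with `log 0 = -∞`). -/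
def ExpStabilizing {Ω : Type*} [MeasurableSpace Ω] {d : ℕ} (ξ : (Fin d → ℝ) → Config d → ℝ≥0)
    (A : Set (Fin d → ℝ)) (N : ℝ → Ω → Config d) (P : Measure Ω) : Prop :=
  ∃ R : ℝ → (Fin d → ℝ) → Ω → ℝ,
    (∀ lam : ℝ, 1 ≤ lam → ∀ x ∈ A, AEMeasurable (R lam x) P ∧
      ∀ᵐ ω ∂P, ∀ X : Config d, (X : Set (Fin d → ℝ)) ⊆ A \ euclBall x ((scale d lam)⁻¹ * R lam x ω) →
        scaled ξ lam x (restr (N lam ω) (euclBall x ((scale d lam)⁻¹ * R lam x ω)) ∪ X) =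
          scaled ξ lam x (restr (N lam ω) (euclBall x ((scale d lam)⁻¹ * R lam x ω)))) ∧
    limsup (fun t : ℝ =>
      ENNReal.log (⨆ (lam : ℝ) (_ : 1 ≤ lam) (x ∈ A), P {ω | t < R lam x ω}) / (t : EReal))
      atTop < 0

/-- `ξ` has a moment of order `p`: `sup_{lam ≥ 1, x ∈ A} E [ξ_lam (x; P_lam) ^ p] < ∞`. -/
def HasMoment {Ω : Type*} [MeasurableSpace Ω] {d : ℕ} (ξ : (Fin d → ℝ) → Config d → ℝ≥0)
    (A : Set (Fin d → ℝ)) (N : ℝ → Ω → Config d) (P : Measure Ω) (p : ℝ) : Prop :=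
  (⨆ (lam : ℝ) (_ : 1 ≤ lam) (x ∈ A), ∫⁻ ω, (scaled ξ lam x (N lam ω) : ℝ≥0∞) ^ p ∂P) < ∞

/-- The measure `μ_lam^ξ = ∑_{x ∈ X ∩ A} ξ_lam (x; X) δ_x` of a configuration `X`. -/
def xiMeasure {d : ℕ} (ξ : (Fin d → ℝ) → Config d → ℝ≥0) (A : Set (Fin d → ℝ)) (lam : ℝ)
    (X : Config d) : Measure (Fin d → ℝ) :=
  ∑ x ∈ restr X A, (scaled ξ lam x X : ℝ≥0∞) • Measure.dirac x

/-- The random variable `⟨f, μ_lam^ξ⟩ = ∫_Γ f dμ_lam^ξ`. -/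
def T {Ω : Type*} {d : ℕ} (ξ : (Fin d → ℝ) → Config d → ℝ≥0) (A : Set (Fin d → ℝ))
    (N : ℝ → Ω → Config d) (Γ : Set (Fin d → ℝ)) (f : (Fin d → ℝ) → ℝ) (lam : ℝ) : Ω → ℝ :=
  fun ω => ∫ x in Γ, f x ∂(xiMeasure ξ A lam (N lam ω))

/-- The closed unit cube centred at the lattice point `w`. -/
def unitCube {d : ℕ} (w : Fin d → ℤ) : Set (Fin d → ℝ) :=
  Metric.closedBall (fun i => (w i : ℝ)) (1 / 2)

/-- The lattice points whose unit cubes are contained in `lam ^ (1/d) B`. -/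
def packing {d : ℕ} (lam : ℝ) (B : Set (Fin d → ℝ)) : Set (Fin d → ℤ) :=
  {w | unitCube w ⊆ scale d lam • B}

/-- The contribution `F_w = ∑_{x ∈ P_lam ∩ lam ^ (-1/d) Q_w} ξ_lam (x; P_lam) f (x)` of the cube
`Q_w`. -/
def cubeSum {Ω : Type*} {d : ℕ} (ξ : (Fin d → ℝ) → Config d → ℝ≥0) (N : ℝ → Ω → Config d)
    (f : (Fin d → ℝ) → ℝ) (lam : ℝ) (w : Fin d → ℤ) : Ω → ℝ :=
  fun ω => ∑ x ∈ restr (N lam ω) ((scale d lam)⁻¹ • unitCube w),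
    (scaled ξ lam x (N lam ω) : ℝ) * f x

/-- For events `Ev w` and random variables `F w`, `w ∈ W`, the σ-algebra generated by the random set
`J = {w ∈ W | Ev w occurs}` and the values of `F w` for `w ∉ J`. -/
@[reducible] def isolationSigma {Ω : Type*} {d : ℕ} (W : Set (Fin d → ℤ)) (Ev : (Fin d → ℤ) → Set Ω)
    (F : (Fin d → ℤ) → Ω → ℝ) : MeasurableSpace Ω :=
  ⨆ w ∈ W, (MeasurableSpace.generateFrom {Ev w} ⊔
    MeasurableSpace.comap ((Ev w)ᶜ.indicator (F w)) inferInstance)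

/-- `μ_lam^ξ` is nondegenerate on `(B, f)`: there are constants `ρ, η > 0` such that for all large
`lam` there are events `Ev w` in the σ-algebra generated by `P_lam`, `w` in the packing, of
probability at least `ρ`, such that, given `G = σ(J, F_w : w ∉ J)` with `J = {w | Ev w occurs}`,
the conditional variance of `F_w` exceeds `η` if `w ∈ J`, and `F_w`, `F_v` are conditionally
independent if `w, v ∈ J` are distinct (the event `w, v ∈ J` belongs to `G`). -/
def Nondegenerate {Ω : Type*} [MeasurableSpace Ω] {d : ℕ} (ξ : (Fin d → ℝ) → Config d → ℝ≥0)
    (N : ℝ → Ω → Config d) (P : Measure Ω) (B : Set (Fin d → ℝ)) (f : (Fin d → ℝ) → ℝ) : Prop :=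
  ∃ ρ η : ℝ, 0 < ρ ∧ 0 < η ∧ ∀ᶠ lam : ℝ in atTop, ∃ Ev : (Fin d → ℤ) → Set Ω,
    (∀ w ∈ packing lam B,
      MeasurableSet[MeasurableSpace.comap (N lam) (configSigma d)] (Ev w) ∧
      ρ ≤ P.real (Ev w)) ∧
    (∀ w ∈ packing lam B, ∀ᵐ ω ∂P, ω ∈ Ev w →
      η < condVar (isolationSigma (packing lam B) Ev (cubeSum ξ N f lam))
        (cubeSum ξ N f lam w) P ω) ∧
    (∀ w ∈ packing lam B, ∀ v ∈ packing lam B, w ≠ v →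
      ∀ S S' : Set ℝ, MeasurableSet S → MeasurableSet S' → ∀ᵐ ω ∂P, ω ∈ Ev w ∩ Ev v →
        (P⟦cubeSum ξ N f lam w ⁻¹' S ∩ cubeSum ξ N f lam v ⁻¹' S' |
            isolationSigma (packing lam B) Ev (cubeSum ξ N f lam)⟧) ω =
          (P⟦cubeSum ξ N f lam w ⁻¹' S |
            isolationSigma (packing lam B) Ev (cubeSum ξ N f lam)⟧) ω *
          (P⟦cubeSum ξ N f lam v ⁻¹' S' |
            isolationSigma (packing lam B) Ev (cubeSum ξ N f lam)⟧) ω)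

/-- The boundary regularity `|∂_r B| = O(r)` as `r ↓ 0`, where `∂_r B` is the set of points at
`ℓ_∞` distance at most `r` from the boundary of `B`. -/
def RegularBoundary {d : ℕ} (B : Set (Fin d → ℝ)) : Prop :=
  (fun r : ℝ => (volume : Measure (Fin d → ℝ)).real (Metric.cthickening r (frontier B)))
    =O[𝓝[>] 0] (fun r : ℝ => r)

end GeomCLT

end

/-! ### Measurability on the space of configurations -/

noncomputable section

namespace GeomCLT

attribute [local instance] configSigma

variable {d : ℕ} {α : Type*} [MeasurableSpace α]

/-! Write σ = lam^(1/d). Almost surely `T` is the sum of the F_w over the packing plus the sum over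
the part of Γ that no cube of the packing covers. The cubes contribute variance at least of order
lam and the uncovered part contributes o(lam). Since Var(X + Y) ≤ 2 Var X + 2 Var Y, the lower bound
passes to `T`.

Cubes (`le_variance_sum_of_condVar`): by the law of total variance, the variance of the sum is at
least its expected conditional variance given G. Given G the terms with w ∉ J are known, and those
with w ∈ J are pairwise uncorrelated with conditional variance above η. Hence the variance is at
least η times the sum of the P(Ev w), so at least ηρ times the number of cubes. Each cube has volume
1/lam and the uncovered part has small volume, so there are at least lam |Γ|/2 cubes for large lam.

Uncovered part (`eventually_variance_boundary_le`): its points lie within ℓ_∞ distance 1/σ of the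
frontier of Γ, so its volume is O(1/σ) and it carries O(lam/σ) points on average. Long-range
dependence is removed in `variance_sum_scaled_le`: the score is recomputed from the points in a ball
of radius s = σ^(θ-1) and cut off at t = σ^τ. The error is small in L² by the moment of order p > 2
and the exponential tail of the stabilization radius. The truncated scores have finite range, so
after grouping the points into cubes of side s each group is correlated with at most 5^d groups.
With θ small the variance is O(lam σ^(-1/2)).

Moments of sums over Poisson points come from the Mecke formula. It is derived from the recursion
(n+1) p(n+1) = r p(n) of the Poisson weights, first for finite partitions, then by a π-λ argument.
-/

theorem mem_restr {X : Config d} {B : Set (Fin d → ℝ)} {x : Fin d → ℝ} :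
    x ∈ restr X B ↔ x ∈ X ∧ x ∈ B := by
  classical
  simp [restr]

theorem measurable_card_restr {B : Set (Fin d → ℝ)} (hB : MeasurableSet B) :
    Measurable (fun X : Config d => (restr X B).card) := by
  rw [measurable_iff_comap_le]
  exact le_iSup₂_of_le B hB le_rfl

theorem measurable_config {N : α → Config d}
    (h : ∀ B : Set (Fin d → ℝ), MeasurableSet B → Measurable fun a => (restr (N a) B).card) :
    Measurable N := by
  rw [measurable_iff_comap_le]
  simp only [configSigma, MeasurableSpace.comap_iSup, MeasurableSpace.comap_comp]
  refine iSup₂_le fun B hB => ?_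
  exact (measurable_iff_comap_le.1 (h B hB))

/-- The counting measure of a configuration. -/
def pointMeasure (X : Config d) : Measure (Fin d → ℝ) := ∑ x ∈ X, Measure.dirac x

theorem lintegral_pointMeasure (X : Config d) (g : (Fin d → ℝ) → ℝ≥0∞) :
    ∫⁻ x, g x ∂(pointMeasure X) = ∑ x ∈ X, g x := by
  simp [pointMeasure]

theorem pointMeasure_apply (X : Config d) {B : Set (Fin d → ℝ)} (hB : MeasurableSet B) :
    pointMeasure X B = (restr X B).card := by
  classical
  simp [pointMeasure, Measure.finsetSum_apply, Measure.dirac_apply' _ hB, restr, indicator_apply,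
    Finset.sum_boole]

/-- The kernel sending a configuration with `n` points to its counting measure, and all other
configurations to `0`. -/
def pointKernel (d n : ℕ) : Kernel (Config d) (Fin d → ℝ) where
  toFun X := if X.card = n then pointMeasure X else 0
  measurable' := by
    have huniv : ∀ X : Config d, restr X univ = X := fun X => by ext; simp [mem_restr]
    have hcard : Measurable fun X : Config d => X.card := by
      simpa only [huniv] using measurable_card_restr (d := d) MeasurableSet.univ
    refine Measurable.ite (hcard (measurableSet_singleton n)) ?_ measurable_const
    refine Measure.measurable_of_measurable_coe _ fun B hB => ?_
    simp only [pointMeasure_apply _ hB]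
    exact (measurable_of_countable _).comp (measurable_card_restr hB)

instance (n : ℕ) : IsFiniteKernel (pointKernel d n) := by
  refine ⟨⟨n, ENNReal.natCast_lt_top n, fun X => ?_⟩⟩
  change (if X.card = n then pointMeasure X else 0) univ ≤ n
  split_ifs with h
  · rw [pointMeasure_apply _ MeasurableSet.univ, ← h]
    simp [restr]
  · simp

/-- The sum is an integral against the counting measure, whose mass is unbounded over
configurations. Stratifying by the number of points gives finite kernels, for which integrals
depending on a parameter are measurable; only the stratum n = card (N a) is nonzero. -/
theorem measurable_sum_points {N : α → Config d} (hN : Measurable N)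
    {g : α → (Fin d → ℝ) → ℝ≥0∞} (hg : Measurable (Function.uncurry g)) :
    Measurable fun a => ∑ x ∈ N a, g a x := by
  have h : ∀ a, ∑ x ∈ N a, g a x =
      ∑' n : ℕ, ∫⁻ x, g a x ∂((pointKernel d n).comap N hN a) := by
    intro a
    rw [tsum_eq_single (N a).card, ← lintegral_pointMeasure]
    · simp [Kernel.comap_apply, pointKernel]
    · intro n hn
      simp [Kernel.comap_apply, pointKernel, hn.symm]
  simp only [h]
  exact Measurable.tsum fun n => Measurable.lintegral_kernel_prod_right hg

theorem sum_points_restr (X : Config d) (B : Set (Fin d → ℝ)) {M : Type*} [AddCommMonoid M]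
    (g : (Fin d → ℝ) → M) : ∑ x ∈ restr X B, g x = ∑ x ∈ X, B.indicator g x := by
  classical
  rw [restr, Finset.sum_filter]
  simp [indicator_apply]

theorem measurable_sum_restr {N : α → Config d} (hN : Measurable N) {B : Set (α × (Fin d → ℝ))}
    (hB : MeasurableSet B) {g : α → (Fin d → ℝ) → ℝ≥0∞} (hg : Measurable (Function.uncurry g)) :
    Measurable fun a => ∑ x ∈ restr (N a) {x | (a, x) ∈ B}, g a x := by
  simp only [sum_points_restr]
  refine measurable_sum_points hN (g := fun a x => {x | (a, x) ∈ B}.indicator (g a) x) ?_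
  have : (Function.uncurry fun a x => {x | (a, x) ∈ B}.indicator (g a) x) =
      B.indicator (Function.uncurry g) := by
    ext ⟨a, x⟩
    by_cases h : (a, x) ∈ B <;> simp [h]
  rw [this]
  exact hg.indicator hB

theorem measurable_sum_restr_real {N : α → Config d} (hN : Measurable N)
    {B : Set (Fin d → ℝ)} (hB : MeasurableSet B)
    {g : α → (Fin d → ℝ) → ℝ} (hg : Measurable (Function.uncurry g)) :
    Measurable fun a => ∑ x ∈ restr (N a) B, g a x := by
  have hB' : MeasurableSet {z : α × (Fin d → ℝ) | z.2 ∈ B} := measurable_snd hB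
  have h : ∀ a, ∑ x ∈ restr (N a) B, g a x =
      (∑ x ∈ restr (N a) B, ENNReal.ofReal (g a x)).toReal -
      (∑ x ∈ restr (N a) B, ENNReal.ofReal (-g a x)).toReal := by
    intro a
    rw [ENNReal.toReal_sum (by simp), ENNReal.toReal_sum (by simp), ← Finset.sum_sub_distrib]
    refine Finset.sum_congr rfl fun x _ => ?_
    rw [ENNReal.toReal_ofReal', ENNReal.toReal_ofReal']
    exact (max_zero_sub_max_neg_zero_eq_self _).symm
  simp only [h]
  exact (measurable_sum_restr hN hB' (g := fun a x => ENNReal.ofReal (g a x))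
      (by exact ENNReal.measurable_ofReal.comp hg)).ennreal_toReal.sub
    (measurable_sum_restr hN hB' (g := fun a x => ENNReal.ofReal (-g a x))
      (by exact ENNReal.measurable_ofReal.comp hg.neg)).ennreal_toReal

/-- The counting set may vary with `a`, as needed for balls around a moving centre and for the
diagonal in `measurable_insert`. -/
theorem measurable_card_points {N : α → Config d} (hN : Measurable N) {B : Set (α × (Fin d → ℝ))}
    (hB : MeasurableSet B) : Measurable fun a => (restr (N a) {x | (a, x) ∈ B}).card := by
  have h := measurable_sum_restr hN hB (g := fun _ _ => 1) measurable_const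
  have h2 : ∀ a, (restr (N a) {x | (a, x) ∈ B}).card =
      Nat.floor (∑ x ∈ restr (N a) {x | (a, x) ∈ B}, (1 : ℝ≥0∞)).toReal := by
    intro a; simp
  simp only [h2]
  exact Nat.measurable_floor.comp h.ennreal_toReal

theorem measurable_restr {N : α → Config d} (hN : Measurable N) {B : Set (α × (Fin d → ℝ))}
    (hB : MeasurableSet B) : Measurable fun a => restr (N a) {x | (a, x) ∈ B} := by
  refine measurable_config fun C hC => ?_
  have h : ∀ a, restr (restr (N a) {x | (a, x) ∈ B}) C =
      restr (N a) {x | (a, x) ∈ B ∩ {z | z.2 ∈ C}} := by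
    intro a; ext x; simp [mem_restr, and_assoc]
  simp only [h]
  exact measurable_card_points hN (hB.inter (measurable_snd hC))

theorem measurable_restr_const {B : Set (Fin d → ℝ)} (hB : MeasurableSet B) :
    Measurable fun X : Config d => restr X B :=
  measurable_restr (N := fun X : Config d => X) measurable_id (measurable_snd hB)

theorem measurable_image {N : α → Config d} (hN : Measurable N)
    {φ : α → (Fin d → ℝ) → (Fin d → ℝ)} (hφ : Measurable (Function.uncurry φ))
    (hinj : ∀ a, Function.Injective (φ a)) : Measurable fun a => (N a).image (φ a) := by
  refine measurable_config fun C hC => ?_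
  have h : ∀ a, (restr ((N a).image (φ a)) C).card =
      (restr (N a) {x | (a, x) ∈ Function.uncurry φ ⁻¹' C}).card := by
    intro a
    rw [← Finset.card_image_of_injective (restr (N a) _) (hinj a)]
    congr 1
    ext y
    simp only [mem_restr, Finset.mem_image, mem_ofPred_eq, mem_preimage, Function.uncurry]
    constructor
    · rintro ⟨⟨z, hz, rfl⟩, hC⟩
      exact ⟨z, ⟨hz, hC⟩, rfl⟩
    · rintro ⟨z, ⟨hz, hC⟩, rfl⟩
      exact ⟨⟨z, hz, rfl⟩, hC⟩
  simp only [h]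
  exact measurable_card_points hN (hφ hC)

/-- This avoids a case distinction on x ∈ X: each term is a count that is measurable in (x, X). The
subtraction of naturals is never truncated. -/
theorem card_restr_insert (x : Fin d → ℝ) (X : Config d) (B : Set (Fin d → ℝ)) :
    (restr (insert x X) B).card =
      (restr X B).card + (restr ({x} : Config d) B).card - (restr X (B ∩ {x})).card := by
  classical
  by_cases hx : x ∈ B
  · by_cases hX : x ∈ X
    · have h1 : restr X (B ∩ {x}) = {x} := by
        ext y; simp only [mem_restr, mem_inter_iff, mem_singleton_iff, Finset.mem_singleton]; aesop
      have h2 : restr ({x} : Config d) B = {x} := by ext y; simp [mem_restr]; aesop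
      rw [h1, h2, Finset.insert_eq_of_mem hX]; simp
    · have h1 : restr X (B ∩ {x}) = ∅ := by
        ext y; simp only [mem_restr, mem_inter_iff, mem_singleton_iff, Finset.notMem_empty]; aesop
      have h2 : restr ({x} : Config d) B = {x} := by ext y; simp [mem_restr]; aesop
      have h3 : restr (insert x X) B = insert x (restr X B) := by
        ext y; simp only [mem_restr, Finset.mem_insert]; aesop
      rw [h1, h2, h3, Finset.card_insert_of_notMem (by simp [mem_restr, hX])]; simp
  · have h1 : restr X (B ∩ {x}) = ∅ := by
      ext y; simp only [mem_restr, mem_inter_iff, mem_singleton_iff, Finset.notMem_empty]; aesop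
    have h2 : restr ({x} : Config d) B = ∅ := by ext y; simp [mem_restr]; aesop
    have h3 : restr (insert x X) B = restr X B := by
      ext y; simp only [mem_restr, Finset.mem_insert]; aesop
    rw [h1, h2, h3]; simp

theorem measurable_singleton_config {u : α → (Fin d → ℝ)} (hu : Measurable u) :
    Measurable fun a => ({u a} : Config d) := by
  classical
  refine measurable_config fun C hC => ?_
  have h : ∀ a, (restr ({u a} : Config d) C).card = (u ⁻¹' C).indicator (fun _ => 1) a := by
    intro a
    by_cases ha : u a ∈ C <;> simp [restr, Finset.filter_singleton, ha]
  simp only [h]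
  exact measurable_const.indicator (hu hC)

theorem measurable_insert {u : α → (Fin d → ℝ)} (hu : Measurable u) {N : α → Config d}
    (hN : Measurable N) : Measurable fun a => insert (u a) (N a) := by
  refine measurable_config fun C hC => ?_
  simp only [card_restr_insert]
  have h1 := (measurable_card_restr hC).comp hN
  have h2 := (measurable_card_restr hC).comp (measurable_singleton_config hu)
  have hS : MeasurableSet {z : α × (Fin d → ℝ) | z.2 ∈ C ∧ z.2 = u z.1} :=
    (measurable_snd hC).inter
      (measurableSet_eq_fun measurable_snd (hu.comp measurable_fst))
  have h3 := measurable_card_points hN hS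
  exact (h1.add h2).sub h3

/-! ### The rescaled functional -/

theorem scale_pos (d : ℕ) {lam : ℝ} (hlam : 0 < lam) : 0 < scale d lam :=
  Real.rpow_pos_of_pos hlam _

theorem scaled_insert (ξ : (Fin d → ℝ) → Config d → ℝ≥0) (lam : ℝ) (x : Fin d → ℝ)
    (X : Config d) : scaled ξ lam x (insert x X) = scaled ξ lam x X := by
  simp [scaled]

theorem measurable_scaled {ξ : (Fin d → ℝ) → Config d → ℝ≥0} (hξ : MeasurableFunctional ξ)
    {lam : ℝ} (hlam : 0 < lam) {u : α → (Fin d → ℝ)} (hu : Measurable u) {N : α → Config d}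
    (hN : Measurable N) : Measurable fun a => scaled ξ lam (u a) (N a) := by
  -- The dilation about `u a` fixes `u a`, so inserting the point before or after rescaling is the
  -- same.
  have h : ∀ a, scaled ξ lam (u a) (N a) =
      ξ (u a) (insert (u a) ((N a).image fun y => u a + scale d lam • (-u a + y))) := by
    intro a
    simp [scaled, Finset.image_insert]
  simp only [h]
  have hφ : Measurable (Function.uncurry fun (a : α) (y : Fin d → ℝ) =>
      u a + scale d lam • (-u a + y)) := by
    have : Measurable fun z : α × (Fin d → ℝ) => u z.1 := hu.comp measurable_fst
    exact this.add (((this.neg).add measurable_snd).const_smul (scale d lam))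
  have himg := measurable_image hN hφ (by
    intro a y z hyz
    simpa [(scale_pos d hlam).ne'] using hyz)
  exact Measurable.comp (g := fun q : (Fin d → ℝ) × Config d => ξ q.1 (insert q.1 q.2)) hξ
    (hu.prodMk himg)

theorem isClosed_euclBall_prod (s : ℝ) :
    IsClosed {z : (Fin d → ℝ) × (Fin d → ℝ) | z.2 ∈ euclBall z.1 s} := by
  have h : Continuous fun z : (Fin d → ℝ) × (Fin d → ℝ) => ‖WithLp.toLp 2 (z.2 - z.1)‖ :=
    ((PiLp.continuous_toLp 2 fun _ : Fin d => ℝ).comp (continuous_snd.sub continuous_fst)).norm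
  exact isClosed_le h continuous_const

end GeomCLT
end

/-! ### The Mecke formula and spatial independence of Poisson processes -/

noncomputable section

namespace GeomCLT

attribute [local instance] configSigma

variable {d : ℕ} {Ω : Type*} [MeasurableSpace Ω]

/-- The recursion of the Poisson weights that makes size-biasing the same as adding one point; the
Mecke formula rests on it. -/
theorem poissonMeasure_succ (r : ℝ≥0) (n : ℕ) :
    (n + 1 : ℕ) * poissonMeasure r {n + 1} = r * poissonMeasure r {n} := by
  rw [poissonMeasure_singleton, poissonMeasure_singleton, ← ENNReal.ofReal_natCast,
    ← ENNReal.ofReal_coe_nnreal, ← ENNReal.ofReal_mul (by positivity),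
    ← ENNReal.ofReal_mul (by positivity)]
  congr 1
  rw [Nat.factorial_succ]
  push_cast
  field_simp
  ring

/-- The numbers of points of `X` in the fibres of `a`. -/
def fibreCount {ι : Type*} (a : (Fin d → ℝ) → ι) (X : Config d) (i : ι) : ℕ :=
  (restr X (a ⁻¹' {i})).card

theorem card_restr_preimage {ι : Type*} [Fintype ι] (a : (Fin d → ℝ) → ι)
    (s : ι → Prop) [DecidablePred s] (X : Config d) :
    (restr X {x | s (a x)}).card = ∑ i with s i, fibreCount a X i := by
  classical
  rw [Finset.card_eq_sum_card_fiberwise (f := a) (t := Finset.univ.filter s)]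
  · refine Finset.sum_congr rfl fun i hi => ?_
    simp only [Finset.mem_filter, Finset.mem_univ, true_and] at hi
    rw [fibreCount]
    congr 1
    ext x
    simp only [Finset.mem_filter, mem_restr, mem_ofPred_eq, mem_preimage, mem_singleton_iff]
    constructor
    · rintro ⟨⟨h1, -⟩, h3⟩
      exact ⟨h1, h3⟩
    · rintro ⟨h1, rfl⟩
      exact ⟨⟨h1, hi⟩, rfl⟩
  · intro x hx
    have := (mem_restr.1 hx).2
    simpa using this

theorem fibreCount_insert {ι : Type*} [DecidableEq ι] (a : (Fin d → ℝ) → ι) {X : Config d}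
    {x : Fin d → ℝ} (hx : x ∉ X) :
    fibreCount a (insert x X) = fibreCount a X + Pi.single (a x) 1 := by
  classical
  funext i
  simp only [fibreCount, Pi.add_apply, Pi.single_apply]
  split_ifs with h
  · have : restr (insert x X) (a ⁻¹' {i}) = insert x (restr X (a ⁻¹' {i})) := by
      ext y; simp only [mem_restr, Finset.mem_insert, mem_preimage, mem_singleton_iff]; aesop
    rw [this, Finset.card_insert_of_notMem (by simp [mem_restr, hx])]
  · have : restr (insert x X) (a ⁻¹' {i}) = restr X (a ⁻¹' {i}) := by
      ext y; simp only [mem_restr, Finset.mem_insert, mem_preimage, mem_singleton_iff]; aesop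
    rw [this, add_zero]

theorem measurableSet_iff_prop {D : Set (Fin d → ℝ)} (hD : MeasurableSet D) (q : Prop) :
    MeasurableSet {x | x ∈ D ↔ q} := by
  by_cases hq : q
  · simpa only [hq, iff_true, ofPred_mem_eq] using hD
  · have : {x | x ∈ D ↔ q} = Dᶜ := by ext x; simp [hq]
    rw [this]
    exact hD.compl

/-- The counting events. -/
def countEvents (d : ℕ) : Set (Set (Config d)) :=
  piiUnionInter (fun B : Set (Fin d → ℝ) =>
    {s | MeasurableSet[MeasurableSpace.comap (fun X : Config d => (restr X B).card) ⊤] s})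
    {B | MeasurableSet B}

theorem generateFrom_countEvents :
    (configSigma d) = MeasurableSpace.generateFrom (countEvents d) :=
  (generateFrom_piiUnionInter_measurableSet
    (fun B : Set (Fin d → ℝ) => MeasurableSpace.comap (fun X : Config d => (restr X B).card) ⊤)
    {B | MeasurableSet B}).symm

theorem isPiSystem_countEvents : IsPiSystem (countEvents d) :=
  isPiSystem_piiUnionInter _ (fun B => @MeasurableSpace.isPiSystem_measurableSet _
    (MeasurableSpace.comap (fun X : Config d => (restr X B).card) ⊤)) _

theorem univ_mem_countEvents : univ ∈ countEvents d :=
  ⟨∅, by simp, fun _ => univ, by simp⟩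

/-- A counting event constrains finitely many counts only, so it can be studied on the atoms of a
finite partition. -/
theorem exists_of_mem_countEvents {E : Set (Config d)} (hE : E ∈ countEvents d) :
    ∃ (t : Finset (Set (Fin d → ℝ))) (H : (t → ℕ) → Prop), (∀ C ∈ t, MeasurableSet C) ∧
      ∀ X, X ∈ E ↔ H fun C => (restr X (C : Set (Fin d → ℝ))).card := by
  obtain ⟨t, ht, F, hF, rfl⟩ := hE
  have h : ∀ C : t, ∃ S : Set ℕ, (fun X : Config d => (restr X (C : Set (Fin d → ℝ))).card) ⁻¹' S
      = F C := by
    intro C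
    obtain ⟨S, -, hS⟩ := hF C C.2
    exact ⟨S, hS⟩
  choose S hS using h
  refine ⟨t, fun n => ∀ C, n C ∈ S C, fun C hC => ht hC, fun X => ?_⟩
  simp only [mem_iInter]
  constructor
  · intro h C
    have := h C C.2
    rw [← hS C] at this
    exact this
  · intro h C hC
    have := h ⟨C, hC⟩
    change X ∈ F (⟨C, hC⟩ : t)
    rw [← hS ⟨C, hC⟩]
    exact this

namespace IsPoissonProcess

variable {N : Ω → Config d} {m : Measure (Fin d → ℝ)} {P : Measure Ω}

theorem iIndepFun_fibreCount (hN : IsPoissonProcess N m P)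
    {ι : Type*} [Fintype ι]
    {a : (Fin d → ℝ) → ι} (ha : ∀ i, MeasurableSet (a ⁻¹' {i})) :
    iIndepFun (fun i ω => fibreCount a (N ω) i) P := by
  let e := Fintype.equivFin ι
  have h := hN.indep (Fintype.card ι) (fun j => a ⁻¹' {e.symm j}) (fun j => ha _) (by
    intro i j hij
    refine Disjoint.preimage a ?_
    simpa using hij)
  have h2 := h.precomp e.injective
  simpa [fibreCount] using h2

theorem measurable_fibreCount (hN : IsPoissonProcess N m P) {ι : Type*}
    {a : (Fin d → ℝ) → ι} (ha : ∀ i, MeasurableSet (a ⁻¹' {i})) (i : ι) :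
    Measurable fun ω => fibreCount a (N ω) i :=
  (measurable_card_restr (ha i)).comp hN.measurable

theorem map_fibreCount_singleton [IsProbabilityMeasure P] (hN : IsPoissonProcess N m P)
    {ι : Type*} [Fintype ι]
    {a : (Fin d → ℝ) → ι} (ha : ∀ i, MeasurableSet (a ⁻¹' {i})) (k : ι → ℕ) :
    P.map (fun ω => fibreCount a (N ω)) {k} =
      ∏ i, poissonMeasure (m (a ⁻¹' {i})).toNNReal {k i} := by
  have h := (iIndepFun_iff_map_fun_eq_pi_map
    (fun i => (hN.measurable_fibreCount ha i).aemeasurable)).1 (hN.iIndepFun_fibreCount ha)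
  change P.map (fun ω i => fibreCount a (N ω) i) {k} = _
  have h3 : ∀ i, P.map (fun ω => fibreCount a (N ω) i) =
    poissonMeasure (m (a ⁻¹' {i})).toNNReal := fun i => hN.law _ (ha i)
  rw [h]
  simp only [h3]
  rw [Measure.pi_singleton]

/-- The Mecke formula on a finite partition. The fibre counts are independent Poisson variables, so
the weight of k is a product; the factor k i lowers the i-th index by one through
`poissonMeasure_succ` and leaves the other factors alone. -/
theorem lintegral_fibreCount_mul [IsProbabilityMeasure P] (hN : IsPoissonProcess N m P)
    {ι : Type*} [Fintype ι]
    [DecidableEq ι] {a : (Fin d → ℝ) → ι} (ha : ∀ i, MeasurableSet (a ⁻¹' {i})) (i : ι)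
    (h : (ι → ℕ) → ℝ≥0∞) :
    ∫⁻ ω, fibreCount a (N ω) i * h (fibreCount a (N ω)) ∂P =
      m (a ⁻¹' {i}) * ∫⁻ ω, h (fibreCount a (N ω) + Pi.single i 1) ∂P := by
  have hm : Measurable fun ω => fibreCount a (N ω) :=
    measurable_pi_lambda _ (hN.measurable_fibreCount ha)
  have hfin : m (a ⁻¹' {i}) ≠ ∞ :=
    ((measure_mono (subset_univ _)).trans_lt hN.intensity_finite).ne
  have hL : ∫⁻ ω, fibreCount a (N ω) i * h (fibreCount a (N ω)) ∂P =
      ∫⁻ k, (k i : ℝ≥0∞) * h k ∂(P.map fun ω => fibreCount a (N ω)) :=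
    (lintegral_map (measurable_of_countable fun k : ι → ℕ => (k i : ℝ≥0∞) * h k) hm).symm
  have hR : ∫⁻ ω, h (fibreCount a (N ω) + Pi.single i 1) ∂P =
      ∫⁻ k, h (k + Pi.single i 1) ∂(P.map fun ω => fibreCount a (N ω)) :=
    (lintegral_map (measurable_of_countable fun k : ι → ℕ => h (k + Pi.single i 1)) hm).symm
  rw [hL, hR, lintegral_countable', lintegral_countable', ← ENNReal.tsum_mul_left]
  -- The shift by one in coordinate i reindexes the series. It misses only the k with k i = 0, whose
  -- terms vanish.
  have hinj : Function.Injective fun k : ι → ℕ => k + Pi.single i 1 := add_left_injective _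
  rw [← hinj.tsum_eq (f := fun k : ι → ℕ => (k i : ℝ≥0∞) * h k *
    (P.map fun ω => fibreCount a (N ω)) {k})]
  · refine tsum_congr fun k => ?_
    rw [hN.map_fibreCount_singleton ha, hN.map_fibreCount_singleton ha]
    rw [← Finset.mul_prod_erase _ _ (Finset.mem_univ i),
      ← Finset.mul_prod_erase _ (fun j => poissonMeasure (m (a ⁻¹' {j})).toNNReal {k j})
        (Finset.mem_univ i)]
    have he : ∏ j ∈ Finset.univ.erase i,
        poissonMeasure (m (a ⁻¹' {j})).toNNReal {(k + Pi.single i 1 : ι → ℕ) j} =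
        ∏ j ∈ Finset.univ.erase i, poissonMeasure (m (a ⁻¹' {j})).toNNReal {k j} := by
      refine Finset.prod_congr rfl fun j hj => ?_
      simp [Finset.ne_of_mem_erase hj]
    have hk : (k + Pi.single i 1 : ι → ℕ) i = k i + 1 := by simp
    have hp := poissonMeasure_succ (m (a ⁻¹' {i})).toNNReal (k i)
    rw [ENNReal.coe_toNNReal hfin] at hp
    rw [he, hk]
    calc _ = ((k i + 1 : ℕ) * poissonMeasure (m (a ⁻¹' {i})).toNNReal {k i + 1}) *
          (h (k + Pi.single i 1) * ∏ j ∈ Finset.univ.erase i,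
            poissonMeasure (m (a ⁻¹' {j})).toNNReal {k j}) := by ring
      _ = _ := by rw [hp]; ring
  · intro k hk
    have hki : k i ≠ 0 := by
      intro h0
      simp [h0] at hk
    refine ⟨k - Pi.single i 1, ?_⟩
    funext j
    by_cases hj : j = i
    · subst hj; simp; omega
    · simp [hj]

theorem ae_restr_eq_empty (hN : IsPoissonProcess N m P) {B : Set (Fin d → ℝ)}
    (hB : MeasurableSet B) (hB0 : m B = 0) : ∀ᵐ ω ∂P, restr (N ω) B = ∅ := by
  have h := hN.law B hB
  rw [hB0, ENNReal.toNNReal_zero] at h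
  have h2 : ∀ᵐ n ∂(poissonMeasure 0), n = 0 := by
    rw [ae_iff]
    have := prob_compl_eq_zero_iff (μ := poissonMeasure 0) (measurableSet_singleton 0)
    refine this.2 ?_
    rw [poissonMeasure_singleton]
    simp
  rw [← h] at h2
  have h3 := ae_of_ae_map ((measurable_card_restr hB).comp hN.measurable).aemeasurable h2
  filter_upwards [h3] with ω hω
  exact Finset.card_eq_zero.1 hω

theorem ae_notMem [NullSingletonClass m] (hN : IsPoissonProcess N m P) (x : Fin d → ℝ) :
    ∀ᵐ ω ∂P, x ∉ N ω := by
  filter_upwards [hN.ae_restr_eq_empty (measurableSet_singleton x) (measure_singleton x)]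
    with ω hω hx
  have : x ∈ restr (N ω) {x} := mem_restr.2 ⟨hx, rfl⟩
  rw [hω] at this
  simp at this

/-- The Mecke formula for rectangles with a counting event. -/
theorem mecke_countEvents [IsProbabilityMeasure P] [NullSingletonClass m]
    (hN : IsPoissonProcess N m P) {B : Set (Fin d → ℝ)}
    (hB : MeasurableSet B) {E : Set (Config d)} (hE : E ∈ countEvents d) :
    ∫⁻ ω, (restr (N ω) B).card * E.indicator 1 (N ω) ∂P =
      ∫⁻ x in B, ∫⁻ ω, E.indicator 1 (insert x (N ω)) ∂P ∂m := by
  classical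
  obtain ⟨t, H, ht, hH⟩ := exists_of_mem_countEvents hE
  -- The membership pattern of x in the sets defining E and in B. Its fibres are the atoms of a
  -- finite partition, and all counts that matter are sums of fibre counts.
  let a : (Fin d → ℝ) → (t → Prop) × Prop := fun x => (fun C => x ∈ (C : Set (Fin d → ℝ)), x ∈ B)
  have ha : ∀ i, MeasurableSet (a ⁻¹' {i}) := by
    intro i
    have : a ⁻¹' {i} = (⋂ C : t, {x | x ∈ (C : Set (Fin d → ℝ)) ↔ i.1 C}) ∩ {x | x ∈ B ↔ i.2} := by
      ext x
      simp [a, Prod.ext_iff, funext_iff]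
    rw [this]
    refine (MeasurableSet.iInter fun C => ?_).inter (measurableSet_iff_prop hB _)
    exact measurableSet_iff_prop (ht C C.2) _
  let h : ((t → Prop) × Prop → ℕ) → ℝ≥0∞ := fun k =>
    if H (fun C => ∑ i with i.1 C, k i) then 1 else 0
  have hEh : ∀ X, E.indicator (1 : Config d → ℝ≥0∞) X = h (fibreCount a X) := by
    intro X
    have : X ∈ E ↔ H (fun C => ∑ i with i.1 C, fibreCount a X i) := by
      rw [hH]
      congr! 2 with C
      exact card_restr_preimage a (fun i => i.1 C) X
    simp only [indicator_apply, h, this, Pi.one_apply]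
  have hcard : ∀ X, (restr X B).card = ∑ i with i.2, fibreCount a X i := fun X =>
    card_restr_preimage a (fun i : (t → Prop) × Prop => i.2) X
  let _ : MeasurableSpace ((t → Prop) × Prop) := ⊤
  have ham : Measurable a := measurable_to_countable' ha
  have hx : ∀ x, ∫⁻ ω, E.indicator (1 : Config d → ℝ≥0∞) (insert x (N ω)) ∂P =
      ∫⁻ ω, h (fibreCount a (N ω) + Pi.single (a x) 1) ∂P := by
    intro x
    -- Since m does not charge points, x is almost surely a new point, and inserting it raises
    -- exactly the fibre count at `a x` by one.
    refine lintegral_congr_ae ?_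
    filter_upwards [hN.ae_notMem x] with ω hω
    rw [hEh, fibreCount_insert a hω]
  have hfm : ∀ i, Measurable fun ω => (fibreCount a (N ω) i : ℝ≥0∞) * h (fibreCount a (N ω)) :=
    fun i => (measurable_of_countable
      fun k : (t → Prop) × Prop → ℕ => (k i : ℝ≥0∞) * h k).comp
      (measurable_pi_lambda _ (hN.measurable_fibreCount ha))
  let φ : (t → Prop) × Prop → ℝ≥0∞ := fun i =>
    if i.2 then ∫⁻ ω, h (fibreCount a (N ω) + Pi.single i 1) ∂P else 0
  calc ∫⁻ ω, (restr (N ω) B).card * E.indicator 1 (N ω) ∂P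
      = ∫⁻ ω, ∑ i with i.2, fibreCount a (N ω) i * h (fibreCount a (N ω)) ∂P := by
        refine lintegral_congr fun ω => ?_
        rw [hEh, hcard, ← Finset.sum_mul]
        push_cast
        rfl
    _ = ∑ i with i.2, m (a ⁻¹' {i}) * ∫⁻ ω, h (fibreCount a (N ω) + Pi.single i 1) ∂P := by
        rw [lintegral_finsetSum _ fun i _ => hfm i]
        exact Finset.sum_congr rfl fun i _ => hN.lintegral_fibreCount_mul ha i h
    _ = ∫⁻ x, φ (a x) ∂m := by
        rw [← lintegral_map (f := φ) (fun _ _ => trivial) ham, lintegral_fintype, Finset.sum_filter]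
        refine Finset.sum_congr rfl fun i _ => ?_
        rw [Measure.map_apply ham (measurableSet_singleton i)]
        simp only [φ]
        split_ifs <;> simp [mul_comm]
    _ = _ := by
        rw [← lintegral_indicator hB]
        refine lintegral_congr fun x => ?_
        by_cases hxB : x ∈ B
        · simp only [φ, a, hxB, if_true, indicator_of_mem, hx]
        · simp only [φ, a, hxB, if_false, indicator_of_notMem, not_false_eq_true]

theorem measurable_sum_dirac (hN : Measurable N) :
    Measurable fun ω => ∑ x ∈ N ω, Measure.dirac (x, N ω) := by
  refine Measure.measurable_of_measurable_coe _ fun S hS => ?_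
  have : ∀ ω, (∑ x ∈ N ω, Measure.dirac (x, N ω)) S =
      ∑ x ∈ N ω, (S.indicator 1 (x, N ω) : ℝ≥0∞) := by
    intro ω
    simp [Measure.finsetSum_apply, Measure.dirac_apply' _ hS]
  simp only [this]
  refine measurable_sum_points hN (g := fun ω x => (S.indicator 1 (x, N ω) : ℝ≥0∞)) ?_
  exact (measurable_one.indicator hS).comp
    (measurable_snd.prodMk (hN.comp measurable_fst))

/-- The Mecke formula. -/
theorem mecke [IsProbabilityMeasure P] [NullSingletonClass m]
    (hN : IsPoissonProcess N m P) {g : (Fin d → ℝ) → Config d → ℝ≥0∞}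
    (hg : Measurable (Function.uncurry g)) :
    ∫⁻ ω, ∑ x ∈ N ω, g x (N ω) ∂P = ∫⁻ x, ∫⁻ ω, g x (insert x (N ω)) ∂P ∂m := by
  classical
  have : IsFiniteMeasure m := ⟨hN.intensity_finite⟩
  have hins : Measurable fun z : (Fin d → ℝ) × Ω => (z.1, insert z.1 (N z.2)) :=
    measurable_fst.prodMk (measurable_insert measurable_fst (hN.measurable.comp measurable_snd))
  have hdir := measurable_sum_dirac hN.measurable
  -- Both sides of the formula are integrals of g against measures on pairs (x, X), so it suffices
  -- to identify these two measures.
  set μ₁ : Measure ((Fin d → ℝ) × Config d) :=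
    P.bind fun ω => ∑ x ∈ N ω, Measure.dirac (x, N ω) with hμ₁
  set μ₂ : Measure ((Fin d → ℝ) × Config d) :=
    (m.prod P).map fun z => (z.1, insert z.1 (N z.2)) with hμ₂
  have h₁ : ∀ G : (Fin d → ℝ) × Config d → ℝ≥0∞, Measurable G →
      ∫⁻ z, G z ∂μ₁ = ∫⁻ ω, ∑ x ∈ N ω, G (x, N ω) ∂P := by
    intro G hG
    rw [hμ₁, Measure.lintegral_bind hdir.aemeasurable hG.aemeasurable]
    refine lintegral_congr fun ω => ?_
    rw [lintegral_finsetSum_measure]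
    exact Finset.sum_congr rfl fun x _ => lintegral_dirac' _ hG
  have h₂ : ∀ G : (Fin d → ℝ) × Config d → ℝ≥0∞, Measurable G →
      ∫⁻ z, G z ∂μ₂ = ∫⁻ x, ∫⁻ ω, G (x, insert x (N ω)) ∂P ∂m := by
    intro G hG
    rw [hμ₂, lintegral_map hG hins,
      lintegral_prod (fun z : (Fin d → ℝ) × Ω => G (z.1, insert z.1 (N z.2)))
      (hG.comp hins).aemeasurable]
  have hind : ∀ (B : Set (Fin d → ℝ)) (E : Set (Config d)) (x : Fin d → ℝ) (X : Config d),
      ((B ×ˢ E).indicator 1 (x, X) : ℝ≥0∞) = B.indicator 1 x * E.indicator 1 X := by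
    intro B E x X
    by_cases h1 : x ∈ B <;> by_cases h2 : X ∈ E <;> simp [h1, h2]
  have hrect : ∀ (B : Set (Fin d → ℝ)) (E : Set (Config d)), MeasurableSet B →
      E ∈ countEvents d → μ₂ (B ×ˢ E) = μ₁ (B ×ˢ E) := by
    intro B E hB hE
    have hEm : MeasurableSet E := by
      rw [generateFrom_countEvents]
      exact MeasurableSpace.measurableSet_generateFrom hE
    rw [← lintegral_indicator_one (hB.prod hEm), ← lintegral_indicator_one (hB.prod hEm),
      h₁ _ (measurable_one.indicator (hB.prod hEm)),
      h₂ _ (measurable_one.indicator (hB.prod hEm))]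
    simp only [hind]
    have hl : ∀ ω, ∑ x ∈ N ω, (B.indicator 1 x * E.indicator 1 (N ω) : ℝ≥0∞) =
        (restr (N ω) B).card * E.indicator 1 (N ω) := by
      intro ω
      rw [← Finset.sum_mul, ← sum_points_restr]
      simp
    simp only [hl]
    rw [hN.mecke_countEvents hB hE, ← lintegral_indicator hB]
    refine lintegral_congr fun x => ?_
    by_cases hx : x ∈ B <;> simp [hx]
  have heq : μ₂ = μ₁ := by
    refine Measure.ext_prod fun {B E} hB hE => ?_
    -- For fixed B both sides are finite measures on configurations that agree on the π-system of
    -- counting events, which generates the σ-algebra and contains `univ`.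
    have hext : (μ₂.restrict (B ×ˢ univ)).map Prod.snd =
        (μ₁.restrict (B ×ˢ univ)).map Prod.snd := by
      have key : ∀ (μ : Measure ((Fin d → ℝ) × Config d)) (S : Set (Config d)), MeasurableSet S →
          (μ.restrict (B ×ˢ univ)).map Prod.snd S = μ (B ×ˢ S) := by
        intro μ S hS
        rw [Measure.map_apply measurable_snd hS, Measure.restrict_apply (measurable_snd hS)]
        congr 1
        ext ⟨x, X⟩
        simp [and_comm]
      refine ext_of_generate_finite _ generateFrom_countEvents isPiSystem_countEvents
        (fun S hS => ?_) ?_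
      · have hSm : MeasurableSet S := by
          rw [generateFrom_countEvents]
          exact MeasurableSpace.measurableSet_generateFrom hS
        rw [key _ _ hSm, key _ _ hSm]
        exact hrect B S hB hS
      · rw [key _ _ MeasurableSet.univ, key _ _ MeasurableSet.univ]
        exact hrect B univ hB univ_mem_countEvents
    have := congrArg (fun μ => μ E) hext
    simp only [Measure.map_apply measurable_snd hE,
      Measure.restrict_apply (measurable_snd hE)] at this
    have hset : Prod.snd ⁻¹' E ∩ B ×ˢ univ = B ×ˢ E := by
      ext ⟨x, X⟩
      simp [and_comm]
    rwa [hset] at this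
  have := h₂ _ hg
  rw [heq, h₁ _ hg] at this
  exact this

/-- A Poisson process restricted to disjoint sets gives independent processes. -/
theorem indepFun_restr [IsProbabilityMeasure P] (hN : IsPoissonProcess N m P)
    {U V : Set (Fin d → ℝ)}
    (hU : MeasurableSet U) (hV : MeasurableSet V) (hUV : Disjoint U V) :
    IndepFun (fun ω => restr (N ω) U) (fun ω => restr (N ω) V) P := by
  classical
  have hmU : Measurable fun ω => restr (N ω) U := (measurable_restr_const hU).comp hN.measurable
  have hmV : Measurable fun ω => restr (N ω) V := (measurable_restr_const hV).comp hN.measurable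
  refine IndepSets.indep hmU.comap_le hmV.comap_le
    (isPiSystem_countEvents.comap fun ω => restr (N ω) U)
    (isPiSystem_countEvents.comap fun ω => restr (N ω) V)
    ?_ ?_ ?_
  · rw [generateFrom_countEvents, MeasurableSpace.comap_generateFrom]; rfl
  · rw [generateFrom_countEvents, MeasurableSpace.comap_generateFrom]; rfl
  rw [IndepSets_iff]
  rintro _ _ ⟨E, hE, rfl⟩ ⟨E', hE', rfl⟩
  obtain ⟨t, H, ht, hH⟩ := exists_of_mem_countEvents hE
  obtain ⟨t', H', ht', hH'⟩ := exists_of_mem_countEvents hE'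
  -- A common finite partition refining U, V and the sets of both events. The first event depends on
  -- the atoms inside U, the second on those inside V; these are disjoint families of independent
  -- counts.
  let a : (Fin d → ℝ) → ((t → Prop) × (t' → Prop)) × (Prop × Prop) := fun x =>
    ((fun C => x ∈ (C : Set (Fin d → ℝ)), fun C => x ∈ (C : Set (Fin d → ℝ))),
      (x ∈ U, x ∈ V ∧ x ∉ U))
  have ha : ∀ i, MeasurableSet (a ⁻¹' {i}) := by
    intro i
    have : a ⁻¹' {i} = ((⋂ C : t, {x | x ∈ (C : Set (Fin d → ℝ)) ↔ i.1.1 C}) ∩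
        (⋂ C : t', {x | x ∈ (C : Set (Fin d → ℝ)) ↔ i.1.2 C})) ∩
        ({x | x ∈ U ↔ i.2.1} ∩ {x | x ∈ V \ U ↔ i.2.2}) := by
      ext x
      simp [a, Prod.ext_iff, funext_iff]
    rw [this]
    refine ((MeasurableSet.iInter fun C => ?_).inter (MeasurableSet.iInter fun C => ?_)).inter
      ((measurableSet_iff_prop hU _).inter (measurableSet_iff_prop (hV.diff hU) _))
    · exact measurableSet_iff_prop (ht C C.2) _
    · exact measurableSet_iff_prop (ht' C C.2) _
  have hind := (hN.iIndepFun_fibreCount ha).indepFun_finset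
    (Finset.univ.filter fun i => i.2.1 ∧ ¬ i.2.2) (Finset.univ.filter fun i => i.2.2 ∧ ¬ i.2.1) (by
      rw [Finset.disjoint_filter]; tauto) (hN.measurable_fibreCount ha)
  have hcU : ∀ (C : t) (X : Config d), (restr (restr X U) C).card =
      ∑ i : (Finset.univ.filter fun i : ((t → Prop) × (t' → Prop)) × (Prop × Prop) =>
        i.2.1 ∧ ¬ i.2.2), if i.1.1.1 C then fibreCount a X i else 0 := by
    intro C X
    rw [Finset.sum_coe_sort (Finset.univ.filter
      fun i : ((t → Prop) × (t' → Prop)) × (Prop × Prop) => i.2.1 ∧ ¬ i.2.2)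
      (fun i => if i.1.1 C then fibreCount a X i else 0), ← Finset.sum_filter,
      Finset.filter_filter,
      ← card_restr_preimage a (fun i => (i.2.1 ∧ ¬ i.2.2) ∧ i.1.1 C) X]
    congr 1
    ext x
    simp only [mem_restr, mem_ofPred_eq, a]
    tauto
  have hcV : ∀ (C : t') (X : Config d), (restr (restr X V) C).card =
      ∑ i : (Finset.univ.filter fun i : ((t → Prop) × (t' → Prop)) × (Prop × Prop) =>
        i.2.2 ∧ ¬ i.2.1), if i.1.1.2 C then fibreCount a X i else 0 := by
    intro C X
    rw [Finset.sum_coe_sort (Finset.univ.filter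
      fun i : ((t → Prop) × (t' → Prop)) × (Prop × Prop) => i.2.2 ∧ ¬ i.2.1)
      (fun i => if i.1.2 C then fibreCount a X i else 0), ← Finset.sum_filter,
      Finset.filter_filter,
      ← card_restr_preimage a (fun i => (i.2.2 ∧ ¬ i.2.1) ∧ i.1.2 C) X]
    congr 1
    ext x
    have hx : x ∈ U → x ∉ V := fun h => disjoint_left.1 hUV h
    simp only [mem_restr, mem_ofPred_eq, a]
    tauto
  have hEset : (fun ω => restr (N ω) U) ⁻¹' E =
      {ω | H fun C => (restr (restr (N ω) U) C).card} := by ext ω; exact hH _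
  have hEset' : (fun ω => restr (N ω) V) ⁻¹' E' =
      {ω | H' fun C => (restr (restr (N ω) V) C).card} := by ext ω; exact hH' _
  rw [indepFun_iff_measure_inter_preimage_eq_mul] at hind
  rw [hEset, hEset']
  simp only [hcU, hcV]
  exact hind
    {k | H fun C => ∑ i : (Finset.univ.filter fun i : ((t → Prop) × (t' → Prop)) × (Prop × Prop) =>
      i.2.1 ∧ ¬ i.2.2), if i.1.1.1 C then k i else 0}
    {k | H' fun C => ∑ i : (Finset.univ.filter fun i : ((t → Prop) × (t' → Prop)) × (Prop × Prop) =>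
      i.2.2 ∧ ¬ i.2.1), if i.1.1.2 C then k i else 0}
    (Set.to_countable _).measurableSet (Set.to_countable _).measurableSet

end IsPoissonProcess

end GeomCLT
end

/-! ### Moment bounds from the Mecke formula -/

noncomputable section

namespace GeomCLT

attribute [local instance] configSigma

variable {d : ℕ} {Ω : Type*} [MeasurableSpace Ω]

theorem card_restr_insert_le (x : Fin d → ℝ) (X : Config d) (D : Set (Fin d → ℝ)) :
    (restr (insert x X) D).card ≤ (restr X D).card + 1 := by
  classical
  refine (Finset.card_le_card ?_).trans (Finset.card_insert_le x _)
  intro y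
  simp only [mem_restr, Finset.mem_insert]
  tauto

namespace IsPoissonProcess

variable {N : Ω → Config d} {m : Measure (Fin d → ℝ)} {P : Measure Ω}

theorem measurable_card_restr_ennreal (hN : IsPoissonProcess N m P) {D : Set (Fin d → ℝ)}
    (hD : MeasurableSet D) : Measurable fun ω => ((restr (N ω) D).card : ℝ≥0∞) :=
  (measurable_of_countable (fun n : ℕ => (n : ℝ≥0∞))).comp
    ((measurable_card_restr hD).comp hN.measurable)

variable [IsProbabilityMeasure P] [NullSingletonClass m]

/-- The Mecke formula on a Borel set, as an inequality for functionals that are bounded at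
configurations with an added point. -/
theorem lintegral_sum_restr_le (hN : IsPoissonProcess N m P) {D : Set (Fin d → ℝ)}
    (hD : MeasurableSet D) {g : (Fin d → ℝ) → Config d → ℝ≥0∞}
    (hg : Measurable (Function.uncurry g)) {b : ℝ≥0∞}
    (hb : ∀ x ∈ D, ∫⁻ ω, g x (insert x (N ω)) ∂P ≤ b) :
    ∫⁻ ω, ∑ x ∈ restr (N ω) D, g x (N ω) ∂P ≤ b * m D := by
  have hg' : Measurable (Function.uncurry fun (x : Fin d → ℝ) (X : Config d) =>
      D.indicator (fun x => g x X) x) := by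
    have : (Function.uncurry fun (x : Fin d → ℝ) (X : Config d) =>
        D.indicator (fun x => g x X) x) = (Prod.fst ⁻¹' D).indicator (Function.uncurry g) := by
      ext ⟨x, X⟩
      by_cases h : x ∈ D <;> simp [h]
    rw [this]
    exact hg.indicator (measurable_fst hD)
  simp only [sum_points_restr]
  rw [hN.mecke hg', ← setLIntegral_const, ← lintegral_indicator hD]
  refine lintegral_mono fun x => ?_
  by_cases hx : x ∈ D
  · simpa [hx] using hb x hx
  · simp [hx]

/-- Moments of the number of points. -/
theorem lintegral_card_add_one_pow_le (hN : IsPoissonProcess N m P) {D : Set (Fin d → ℝ)}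
    (hD : MeasurableSet D) {M : ℝ≥0∞} (hM : m D ≤ M) (k : ℕ) :
    ∫⁻ ω, ((restr (N ω) D).card + 1 : ℝ≥0∞) ^ k ∂P ≤ 2 ^ (k * k) * (1 + M) ^ k := by
  have hc := hN.measurable_card_restr_ennreal hD
  have hcX : Measurable fun X : Config d => ((restr X D).card : ℝ≥0∞) :=
    (measurable_of_countable (fun n : ℕ => (n : ℝ≥0∞))).comp (measurable_card_restr hD)
  induction k with
  | zero => simp
  | succ k ih =>
    set I := ∫⁻ ω, ((restr (N ω) D).card + 1 : ℝ≥0∞) ^ k ∂P with hI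
    -- Writing (n+1)^(k+1) = n (n+1)^k + (n+1)^k makes the first term a sum over points. The Mecke
    -- formula turns its count n into at most n + 1, and (n+2)^k ≤ 2^k (n+1)^k closes the induction.
    have h1 : ∫⁻ ω, ((restr (N ω) D).card + 1 : ℝ≥0∞) ^ (k + 1) ∂P =
        ∫⁻ ω, ∑ x ∈ restr (N ω) D, ((restr (N ω) D).card + 1 : ℝ≥0∞) ^ k ∂P + I := by
      rw [hI, ← lintegral_add_right _ ((hc.add_const 1).pow_const k)]
      refine lintegral_congr fun ω => ?_
      rw [Finset.sum_const, nsmul_eq_mul]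
      ring
    have h2 : ∫⁻ ω, ∑ x ∈ restr (N ω) D, ((restr (N ω) D).card + 1 : ℝ≥0∞) ^ k ∂P ≤
        2 ^ k * I * m D := by
      refine hN.lintegral_sum_restr_le hD
        (g := fun _ X => ((restr X D).card + 1 : ℝ≥0∞) ^ k)
        (((hcX.add_const 1).pow_const k).comp measurable_snd) fun x _ => ?_
      rw [hI, ← lintegral_const_mul _ ((hc.add_const 1).pow_const k)]
      refine lintegral_mono fun ω => ?_
      rw [← mul_pow]
      refine pow_le_pow_left' ?_ k
      have := card_restr_insert_le x (N ω) D
      have h3 : ((restr (insert x (N ω)) D).card : ℝ≥0∞) ≤ (restr (N ω) D).card + 1 := by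
        exact_mod_cast this
      calc ((restr (insert x (N ω)) D).card : ℝ≥0∞) + 1 ≤ (restr (N ω) D).card + 1 + 1 := by gcongr
        _ ≤ 2 * (restr (N ω) D).card + 1 + 1 := by
          gcongr
          exact le_mul_of_one_le_left zero_le one_le_two
        _ = _ := by ring
    have h2k : (1 : ℝ≥0∞) ≤ 2 ^ k := one_le_pow₀ one_le_two
    calc _ ≤ 2 ^ k * I * M + 2 ^ k * I := by
          rw [h1]
          gcongr
          · exact h2.trans (by gcongr)
          · exact le_mul_of_one_le_left zero_le h2k
      _ = 2 ^ k * (1 + M) * I := by ring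
      _ ≤ 2 ^ k * (1 + M) * (2 ^ (k * k) * (1 + M) ^ k) := by gcongr
      _ = 2 ^ (k + k * k) * (1 + M) ^ (k + 1) := by ring
      _ ≤ _ := by
          gcongr
          · exact one_le_two
          · nlinarith

/-- Second moments of sums over the points in a Borel set. -/
theorem lintegral_sum_restr_sq_le (hN : IsPoissonProcess N m P) {D : Set (Fin d → ℝ)}
    (hD : MeasurableSet D) {g : (Fin d → ℝ) → Config d → ℝ≥0∞}
    (hg : Measurable (Function.uncurry g)) {b : ℝ≥0∞}
    (hb : ∀ x ∈ D, ∫⁻ ω, ((restr (N ω) D).card + 1) * g x (insert x (N ω)) ^ 2 ∂P ≤ b) :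
    ∫⁻ ω, (∑ x ∈ restr (N ω) D, g x (N ω)) ^ 2 ∂P ≤ b * m D := by
  have hcX : Measurable fun X : Config d => ((restr X D).card : ℝ≥0∞) :=
    (measurable_of_countable (fun n : ℕ => (n : ℝ≥0∞))).comp (measurable_card_restr hD)
  calc ∫⁻ ω, (∑ x ∈ restr (N ω) D, g x (N ω)) ^ 2 ∂P
      ≤ ∫⁻ ω, ∑ x ∈ restr (N ω) D, (restr (N ω) D).card * g x (N ω) ^ 2 ∂P := by
        refine lintegral_mono fun ω => ?_
        rw [← Finset.mul_sum]
        -- Cauchy–Schwarz: the square of a sum of n terms is at most n times the sum of squares,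
        -- which is again a sum over points.
        have := ENNReal.rpow_sum_le_const_mul_sum_rpow (restr (N ω) D) (fun x => g x (N ω))
          (p := 2) one_le_two
        have h2 : (2 : ℝ) - 1 = 1 := by norm_num
        simpa [h2] using this
    _ ≤ b * m D := by
        refine hN.lintegral_sum_restr_le hD (g := fun x X => (restr X D).card * g x X ^ 2)
          (by exact (hcX.comp measurable_snd).mul (hg.pow_const 2)) fun x hx => ?_
        refine (lintegral_mono fun ω => ?_).trans (hb x hx)
        gcongr
        exact_mod_cast card_restr_insert_le x (N ω) D

theorem lintegral_card_add_one_rpow_rpow_le (hN : IsPoissonProcess N m P) {D : Set (Fin d → ℝ)}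
    (hD : MeasurableSet D) {M : ℝ≥0∞} (hM : m D ≤ M) {a : ℝ} (ha : 1 ≤ a) {k : ℕ} (hk : a ≤ k) :
    (∫⁻ ω, ((restr (N ω) D).card + 1 : ℝ≥0∞) ^ a ∂P) ^ (1 / a) ≤ 2 ^ (k * k) * (1 + M) ^ k := by
  have h1 : ∀ ω, (1 : ℝ≥0∞) ≤ (restr (N ω) D).card + 1 := fun ω => le_add_self
  refine le_trans ?_ (hN.lintegral_card_add_one_pow_le hD hM k)
  have h2 : ∫⁻ ω, ((restr (N ω) D).card + 1 : ℝ≥0∞) ^ a ∂P ≤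
      ∫⁻ ω, ((restr (N ω) D).card + 1 : ℝ≥0∞) ^ k ∂P := by
    refine lintegral_mono fun ω => ?_
    rw [← ENNReal.rpow_natCast]
    exact ENNReal.rpow_le_rpow_of_exponent_le (h1 ω) hk
  have h3 : 1 ≤ ∫⁻ ω, ((restr (N ω) D).card + 1 : ℝ≥0∞) ^ k ∂P := by
    calc (1 : ℝ≥0∞) = ∫⁻ _, 1 ∂P := by simp
      _ ≤ _ := lintegral_mono fun ω => one_le_pow₀ (h1 ω)
  calc _ ≤ (∫⁻ ω, ((restr (N ω) D).card + 1 : ℝ≥0∞) ^ k ∂P) ^ (1 / a) := by gcongr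
    _ ≤ (∫⁻ ω, ((restr (N ω) D).card + 1 : ℝ≥0∞) ^ k ∂P) ^ (1 : ℝ) :=
        -- The exponent 1/a may be raised to 1 because the moment is at least 1.
        ENNReal.rpow_le_rpow_of_exponent_le h3 (by
          rw [div_le_one (by linarith)]; exact ha)
    _ = _ := ENNReal.rpow_one _

/-- Hölder's inequality against the number of points. -/
theorem lintegral_card_add_one_mul_le (hN : IsPoissonProcess N m P) {D : Set (Fin d → ℝ)}
    (hD : MeasurableSet D) {M : ℝ≥0∞} (hM : m D ≤ M) {a b : ℝ} (hab : a.HolderConjugate b)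
    {k : ℕ} (hk : a ≤ k) {h : Ω → ℝ≥0∞} (hh : Measurable h) :
    ∫⁻ ω, ((restr (N ω) D).card + 1) * h ω ∂P ≤
      2 ^ (k * k) * (1 + M) ^ k * (∫⁻ ω, h ω ^ b ∂P) ^ (1 / b) := by
  refine (ENNReal.lintegral_mul_le_Lp_mul_Lq P hab
    ((hN.measurable_card_restr_ennreal hD).add_const 1).aemeasurable hh.aemeasurable).trans ?_
  gcongr
  exact hN.lintegral_card_add_one_rpow_rpow_le hD hM hab.lt.le hk

end IsPoissonProcess

/-! ### Sums with local dependence -/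

theorem covariance_le_half_variance_add {P : Measure Ω} [IsProbabilityMeasure P] {X Y : Ω → ℝ}
    (hX : MemLp X 2 P) (hY : MemLp Y 2 P) :
    covariance X Y P ≤ (variance X P + variance Y P) / 2 := by
  have h := variance_sub hX hY
  have := variance_nonneg (X - Y) P
  linarith

/-- Only near pairs have nonzero covariance, and each such covariance is at most the mean of the two
variances. By symmetry of `near` both halves contribute equally, and every variance is counted at
most n times. -/
theorem variance_sum_le_of_local {P : Measure Ω} [IsProbabilityMeasure P] {ι : Type*}
    (V : Finset ι) (near : ι → ι → Prop) [DecidableRel near] (hsymm : ∀ u v, near u v → near v u)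
    (n : ℕ) (hn : ∀ u ∈ V, (V.filter (near u)).card ≤ n) {Y : ι → Ω → ℝ}
    (hY : ∀ v ∈ V, MemLp (Y v) 2 P)
    (hcov : ∀ u ∈ V, ∀ v ∈ V, ¬ near u v → covariance (Y u) (Y v) P = 0) :
    variance (∑ v ∈ V, Y v) P ≤ n * ∑ v ∈ V, variance (Y v) P := by
  rw [variance_sum' hY]
  have h1 : ∀ u ∈ V, ∑ v ∈ V, covariance (Y u) (Y v) P ≤
      ∑ v ∈ V with near u v, (variance (Y u) P + variance (Y v) P) / 2 := by
    intro u hu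
    rw [Finset.sum_filter]
    refine Finset.sum_le_sum fun v hv => ?_
    split_ifs with h
    · exact covariance_le_half_variance_add (hY u hu) (hY v hv)
    · exact (hcov u hu v hv h).le
  refine (Finset.sum_le_sum h1).trans ?_
  have h2 : ∑ u ∈ V, ∑ v ∈ V with near u v, variance (Y u) P ≤ n * ∑ v ∈ V, variance (Y v) P := by
    rw [Finset.mul_sum]
    refine Finset.sum_le_sum fun u hu => ?_
    rw [Finset.sum_const, nsmul_eq_mul]
    exact mul_le_mul_of_nonneg_right (by exact_mod_cast hn u hu) (variance_nonneg _ _)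
  have h3 : ∑ u ∈ V, ∑ v ∈ V with near u v, variance (Y v) P =
      ∑ u ∈ V, ∑ v ∈ V with near u v, variance (Y u) P := by
    simp only [Finset.sum_filter]
    rw [Finset.sum_comm]
    refine Finset.sum_congr rfl fun u _ => Finset.sum_congr rfl fun v _ => ?_
    have : near v u ↔ near u v := ⟨hsymm _ _, hsymm _ _⟩
    simp only [this]
  simp only [add_div, Finset.sum_add_distrib]
  simp only [← Finset.sum_div]
  rw [h3]
  linarith

end GeomCLT
end

/-! ### Lower bound for a variance by conditioning -/

noncomputable section

namespace GeomCLT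

theorem integrable_mul_of_memLp_two {Ω : Type*} [MeasurableSpace Ω] {P : Measure Ω}
    {f g : Ω → ℝ} (hf : MemLp f 2 P) (hg : MemLp g 2 P) :
    Integrable (fun ω => f ω * g ω) P :=
  hf.integrable_mul hg

section CondVariance

variable {Ω : Type*} {G m0 : MeasurableSpace Ω} {P : Measure Ω} [IsProbabilityMeasure P]

/-- The hypothesis says that Z has conditional expectation 0 given σ(F), and F can be pulled out.
This passes from events {F ∈ S} to F itself without approximation by simple functions. -/
theorem integral_mul_eq_zero_of_setIntegral_preimage {F Z : Ω → ℝ} (hF : Measurable F)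
    (hF2 : MemLp F 2 P) (hZ : MemLp Z 2 P)
    (h : ∀ S : Set ℝ, MeasurableSet S → ∫ ω in F ⁻¹' S, Z ω ∂P = 0) :
    ∫ ω, F ω * Z ω ∂P = 0 := by
  have hm : MeasurableSpace.comap F inferInstance ≤ m0 := hF.comap_le
  have hZi : Integrable Z P := hZ.integrable one_le_two
  have h0 : (0 : Ω → ℝ) =ᵐ[P] P[Z | MeasurableSpace.comap F inferInstance] := by
    refine ae_eq_condExp_of_forall_setIntegral_eq hm hZi
      (fun s _ _ => (integrable_zero Ω ℝ P).integrableOn) ?_ aestronglyMeasurable_zero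
    rintro _ ⟨S, hS, rfl⟩ _
    simp [h S hS]
  have h1 := condExp_mul_of_stronglyMeasurable_left (μ := P)
    (comap_measurable F).stronglyMeasurable (hF2.integrable_mul hZ) hZi
  have h2 := integral_condExp (μ := P) hm (f := F * Z)
  change ∫ ω, (F * Z) ω ∂P = 0
  rw [← h2, ← integral_zero Ω ℝ (μ := P)]
  refine integral_congr_ae ?_
  filter_upwards [h0, h1] with ω h3 h4
  rw [h4, Pi.mul_apply, ← h3]
  simp

theorem integral_condExp_mul (hG : G ≤ m0) {f g : Ω → ℝ} (hf : MemLp f 2 P) (hg : MemLp g 2 P) :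
    ∫ ω, P[f | G] ω * g ω ∂P = ∫ ω, P[f | G] ω * P[g | G] ω ∂P := by
  have h1 := condExp_mul_of_stronglyMeasurable_left (μ := P)
    (stronglyMeasurable_condExp (f := f) (m := G)) ((hf.condExp one_le_two).integrable_mul hg)
    (hg.integrable one_le_two)
  have h2 := integral_condExp (μ := P) hG (f := P[f | G] * g)
  change ∫ ω, (P[f | G] * g) ω ∂P = _
  rw [← h2]
  exact integral_congr_ae h1

/-- Self-adjointness of the L² projection onto the G-measurable variables. -/
theorem integral_condExp_mul_comm (hG : G ≤ m0) {f g : Ω → ℝ} (hf : MemLp f 2 P)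
    (hg : MemLp g 2 P) :
    ∫ ω, P[f | G] ω * g ω ∂P = ∫ ω, f ω * P[g | G] ω ∂P := by
  rw [integral_condExp_mul hG hf hg]
  have := integral_condExp_mul hG hg hf
  calc _ = ∫ ω, P[g | G] ω * P[f | G] ω ∂P := by simp only [mul_comm]
    _ = ∫ ω, P[g | G] ω * f ω ∂P := this.symm
    _ = _ := by simp only [mul_comm]

theorem condExp_indicator_sub_self (hG : G ≤ m0) {E : Set Ω} (hE : MeasurableSet[G] E)
    {f : Ω → ℝ} (hf : MemLp f 2 P) :
    P[E.indicator (f - P[f | G]) | G] =ᵐ[P] 0 := by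
  have hfi := hf.integrable one_le_two
  have h1 := condExp_indicator (μ := P) (hfi.sub integrable_condExp) hE (m := G)
    (f := f - P[f | G])
  have h2 := condExp_sub (μ := P) hfi (integrable_condExp (f := f) (m := G)) G
  have h3 := condExp_of_stronglyMeasurable hG (stronglyMeasurable_condExp (f := f) (m := G))
    (integrable_condExp (μ := P))
  filter_upwards [h1, h2] with ω h4 h5
  rw [h4]
  by_cases hω : ω ∈ E
  · rw [indicator_of_mem hω, h5, Pi.sub_apply, h3]
    simp
  · simp [hω]

/-- Conditional independence of `X` and `Y` given `G` on an event of `G` implies that the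
conditional covariance vanishes there. -/
theorem integral_indicator_sub_condExp_mul_eq_zero (hG : G ≤ m0) {E : Set Ω}
    (hE : MeasurableSet[G] E) {X Y : Ω → ℝ} (hXm : Measurable X) (hYm : Measurable Y)
    (hX : MemLp X 2 P) (hY : MemLp Y 2 P)
    (h : ∀ S S' : Set ℝ, MeasurableSet S → MeasurableSet S' → ∀ᵐ ω ∂P, ω ∈ E →
      (P⟦X ⁻¹' S ∩ Y ⁻¹' S' | G⟧) ω = (P⟦X ⁻¹' S | G⟧) ω * (P⟦Y ⁻¹' S' | G⟧) ω) :
    ∫ ω, (Y - P[Y | G]) ω * E.indicator (X - P[X | G]) ω ∂P = 0 := by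
  have hE0 : MeasurableSet E := hG _ hE
  have h1 : ∀ s : Set Ω, MeasurableSet s → MemLp (s.indicator fun _ => (1 : ℝ)) 2 P :=
    fun s hs => memLp_indicator_const 2 hs 1 (Or.inr (measure_ne_top P s))
  have hXE : MemLp (X - P[X | G]) 2 P := hX.sub (hX.condExp one_le_two)
  have hind : ∀ f : Ω → ℝ, MemLp f 2 P → P[E.indicator f | G] =ᵐ[P] E.indicator (P[f | G]) :=
    fun f hf => condExp_indicator (hf.integrable one_le_two) hE
  -- With S' fixed, the events {X ∈ S} are upgraded to X.
  have step1 : ∀ S' : Set ℝ, MeasurableSet S' →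
      ∫ ω, X ω * E.indicator ((Y ⁻¹' S').indicator (fun _ => (1 : ℝ)) - P⟦Y ⁻¹' S' | G⟧) ω ∂P
        = 0 := by
    intro S' hS'
    have hY1 := h1 _ (hYm hS')
    refine integral_mul_eq_zero_of_setIntegral_preimage hXm hX
      ((hY1.sub (hY1.condExp one_le_two)).indicator hE0) fun S hS => ?_
    have hX1 := h1 _ (hXm hS)
    have hsplit : ∀ ω, (X ⁻¹' S).indicator (E.indicator
        ((Y ⁻¹' S').indicator (fun _ => (1 : ℝ)) - P⟦Y ⁻¹' S' | G⟧)) ω =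
        E.indicator ((X ⁻¹' S ∩ Y ⁻¹' S').indicator fun _ => (1 : ℝ)) ω -
        E.indicator (P⟦Y ⁻¹' S' | G⟧) ω * (X ⁻¹' S).indicator (fun _ => (1 : ℝ)) ω := by
      intro ω
      by_cases hx : ω ∈ X ⁻¹' S <;> by_cases he : ω ∈ E <;> by_cases hy : ω ∈ Y ⁻¹' S' <;>
        simp only [mem_inter_iff, hx, he, hy, indicator_of_mem, indicator_of_notMem,
          not_false_eq_true, Pi.sub_apply, and_self, and_true, and_false, mul_one,
          mul_zero, sub_zero]
    have hXY := h1 _ ((hXm hS).inter (hYm hS'))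
    rw [← integral_indicator (hXm hS)]
    simp only [hsplit]
    rw [integral_sub ((hXY.indicator hE0).integrable one_le_two)
      (integrable_mul_of_memLp_two ((hY1.condExp one_le_two).indicator hE0) hX1), sub_eq_zero,
      integral_indicator hE0,
      ← setIntegral_condExp hG (hXY.integrable one_le_two) hE, ← integral_indicator hE0]
    calc _ = ∫ ω, P[E.indicator ((Y ⁻¹' S').indicator fun _ => (1 : ℝ)) | G] ω *
          (P⟦X ⁻¹' S | G⟧) ω ∂P := by
          refine integral_congr_ae ?_
          filter_upwards [h S S' hS hS', hind _ hY1] with ω h2 h3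
          rw [h3]
          by_cases he : ω ∈ E
          · simp only [he, indicator_of_mem]
            rw [h2 he, mul_comm]
          · simp [he]
      _ = ∫ ω, P[E.indicator ((Y ⁻¹' S').indicator fun _ => (1 : ℝ)) | G] ω *
          (X ⁻¹' S).indicator (fun _ => (1 : ℝ)) ω ∂P :=
          (integral_condExp_mul hG (hY1.indicator hE0) hX1).symm
      _ = _ := by
          refine integral_congr_ae ?_
          filter_upwards [hind _ hY1] with ω h3
          rw [h3]
  -- The events {Y ∈ S'} are upgraded to Y; by self-adjointness the conditional expectation moves
  -- from the indicator of {Y ∈ S'} to X.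
  have step2 : ∫ ω, Y ω * E.indicator (X - P[X | G]) ω ∂P = 0 := by
    refine integral_mul_eq_zero_of_setIntegral_preimage hYm hY (hXE.indicator hE0)
      fun S' hS' => ?_
    have hY1 := h1 _ (hYm hS')
    have hs := step1 S' hS'
    have hsplit : ∀ ω, X ω * E.indicator
        ((Y ⁻¹' S').indicator (fun _ => (1 : ℝ)) - P⟦Y ⁻¹' S' | G⟧) ω =
        X ω * E.indicator ((Y ⁻¹' S').indicator fun _ => (1 : ℝ)) ω -
        X ω * E.indicator (P⟦Y ⁻¹' S' | G⟧) ω := by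
      intro ω
      by_cases he : ω ∈ E <;>
        simp only [he, indicator_of_mem, indicator_of_notMem, not_false_eq_true, Pi.sub_apply,
          mul_sub, mul_zero, sub_zero]
    simp only [hsplit] at hs
    rw [integral_sub (integrable_mul_of_memLp_two hX (hY1.indicator hE0))
      (integrable_mul_of_memLp_two hX ((hY1.condExp one_le_two).indicator hE0)), sub_eq_zero] at hs
    have hc : ∫ ω, X ω * E.indicator (P⟦Y ⁻¹' S' | G⟧) ω ∂P =
        ∫ ω, P[X | G] ω * E.indicator ((Y ⁻¹' S').indicator fun _ => (1 : ℝ)) ω ∂P := by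
      rw [integral_condExp_mul_comm hG hX (hY1.indicator hE0)]
      refine integral_congr_ae ?_
      filter_upwards [hind _ hY1] with ω h3
      rw [h3]
    rw [hc] at hs
    rw [← integral_indicator (hYm hS')]
    have hsplit2 : ∀ ω, (Y ⁻¹' S').indicator (E.indicator (X - P[X | G])) ω =
        X ω * E.indicator ((Y ⁻¹' S').indicator fun _ => (1 : ℝ)) ω -
        P[X | G] ω * E.indicator ((Y ⁻¹' S').indicator fun _ => (1 : ℝ)) ω := by
      intro ω
      by_cases he : ω ∈ E <;> by_cases hy : ω ∈ Y ⁻¹' S' <;>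
        simp only [he, hy, indicator_of_mem, indicator_of_notMem, not_false_eq_true, Pi.sub_apply,
          mul_one, mul_zero, sub_zero]
    simp only [hsplit2]
    rw [integral_sub (integrable_mul_of_memLp_two hX (hY1.indicator hE0))
      (integrable_mul_of_memLp_two (hX.condExp one_le_two) (hY1.indicator hE0)), hs, sub_self]
  -- The G-measurable part of Y is orthogonal to a variable with conditional mean 0.
  have step3 : ∫ ω, P[Y | G] ω * E.indicator (X - P[X | G]) ω ∂P = 0 := by
    rw [integral_condExp_mul hG hY (hXE.indicator hE0)]
    rw [← integral_zero Ω ℝ (μ := P)]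
    refine integral_congr_ae ?_
    filter_upwards [condExp_indicator_sub_self hG hE hX] with ω h2
    rw [h2]
    simp
  simp only [Pi.sub_apply, sub_mul]
  rw [integral_sub (integrable_mul_of_memLp_two hY (hXE.indicator hE0))
    (integrable_mul_of_memLp_two (hY.condExp one_le_two) (hXE.indicator hE0)),
    step2, step3, sub_zero]

/-- The law of total variance without the variance of the conditional mean. -/
theorem integral_sub_condExp_sq_le_variance (hG : G ≤ m0) {X : Ω → ℝ} (hX : MemLp X 2 P) :
    ∫ ω, (X ω - P[X | G] ω) ^ 2 ∂P ≤ variance X P := by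
  rw [← integral_condVar_add_variance_condExp hG hX]
  have : ∫ ω, (X ω - P[X | G] ω) ^ 2 ∂P = ∫ ω, condVar G X P ω ∂P :=
    (integral_condExp hG).symm
  rw [this]
  linarith [variance_nonneg (P[X | G]) P]

/-- If given `G` the variables `F w` are known off the events `Ev w`, have conditional variance
more than `η` on `Ev w`, and are pairwise conditionally independent there, then the variance of
their sum is at least `η` times the expected number of the events that occur. -/
theorem le_variance_sum_of_condVar {ι : Type*} (hG : G ≤ m0) (W : Finset ι) {F : ι → Ω → ℝ}
    {Ev : ι → Set Ω} {η : ℝ} (hFm : ∀ w ∈ W, Measurable (F w)) (hF : ∀ w ∈ W, MemLp (F w) 2 P)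
    (hEv : ∀ w ∈ W, MeasurableSet[G] (Ev w))
    (hFE : ∀ w ∈ W, Measurable[G] ((Ev w)ᶜ.indicator (F w)))
    (hvar : ∀ w ∈ W, ∀ᵐ ω ∂P, ω ∈ Ev w → η < condVar G (F w) P ω)
    (hind : ∀ w ∈ W, ∀ v ∈ W, w ≠ v → ∀ S S' : Set ℝ, MeasurableSet S → MeasurableSet S' →
      ∀ᵐ ω ∂P, ω ∈ Ev w ∩ Ev v →
        (P⟦F w ⁻¹' S ∩ F v ⁻¹' S' | G⟧) ω = (P⟦F w ⁻¹' S | G⟧) ω * (P⟦F v ⁻¹' S' | G⟧) ω) :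
    η * ∑ w ∈ W, P.real (Ev w) ≤ variance (fun ω => ∑ w ∈ W, F w ω) P := by
  classical
  set D : ι → Ω → ℝ := fun w => (Ev w).indicator (F w - P[F w | G]) with hD
  have hD2 : ∀ w ∈ W, MemLp (D w) 2 P := fun w hw =>
    ((hF w hw).sub ((hF w hw).condExp one_le_two)).indicator (hG _ (hEv w hw))
  -- Off `Ev w` the variable F w is G-measurable, so centring it conditionally gives 0 there and the
  -- cut-off in D w loses nothing.
  have hDeq : ∀ w ∈ W, F w - P[F w | G] =ᵐ[P] D w := by
    intro w hw
    have hFi := (hF w hw).integrable one_le_two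
    have h1 := condExp_indicator (μ := P) hFi (hEv w hw).compl (m := G)
    have h2 := condExp_of_stronglyMeasurable (μ := P) hG (hFE w hw).stronglyMeasurable
      (hFi.indicator (hG _ (hEv w hw).compl))
    rw [h2] at h1
    filter_upwards [h1] with ω h3
    by_cases hω : ω ∈ Ev w
    · simp [hD, hω]
    · have hω' : ω ∈ (Ev w)ᶜ := hω
      rw [indicator_of_mem hω', indicator_of_mem hω'] at h3
      simp [hD, hω, h3]
  -- The product D w · D v lives on `Ev w ∩ Ev v`, where conditional independence applies.
  have hcov : ∀ w ∈ W, ∀ v ∈ W, v ≠ w → ∫ ω, D w ω * D v ω ∂P = 0 := by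
    intro w hw v hv hne
    have h1 := integral_indicator_sub_condExp_mul_eq_zero hG
      ((hEv w hw).inter (hEv v hv)) (hFm w hw) (hFm v hv) (hF w hw) (hF v hv)
      (hind w hw v hv hne.symm)
    rw [← h1]
    congr 1
    funext ω
    by_cases h2 : ω ∈ Ev w <;> by_cases h3 : ω ∈ Ev v <;> simp [hD, h2, h3, mul_comm]
  have hsq : ∀ w ∈ W, η * P.real (Ev w) ≤ ∫ ω, D w ω * D w ω ∂P := by
    intro w hw
    have hE0 := hG _ (hEv w hw)
    have h1 : ∫ ω, D w ω * D w ω ∂P = ∫ ω in Ev w, condVar G (F w) P ω ∂P := by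
      rw [setIntegral_condVar (hm := hG)
        ((hF w hw).sub ((hF w hw).condExp one_le_two)).integrable_sq
        (hEv w hw), ← integral_indicator hE0]
      congr 1
      funext ω
      by_cases h2 : ω ∈ Ev w <;> simp [hD, h2, sq]
    rw [h1]
    have h3 := setIntegral_mono_on_ae (μ := P) (f := fun _ => η)
      (integrableOn_const (measure_ne_top P (Ev w)))
      (integrable_condVar.integrableOn) hE0
      ((hvar w hw).mono fun ω h hω => (h hω).le)
    simpa [mul_comm] using h3
  have hX : MemLp (fun ω => ∑ w ∈ W, F w ω) 2 P := memLp_finsetSum W hF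
  refine le_trans ?_ (integral_sub_condExp_sq_le_variance hG hX)
  have hce : P[fun ω => ∑ w ∈ W, F w ω | G] =ᵐ[P] ∑ w ∈ W, P[F w | G] := by
    have := condExp_finsetSum (μ := P) (s := W) (f := F)
      (fun w hw => (hF w hw).integrable one_le_two) G
    convert this using 2
    ext ω
    simp
  have hall : ∀ᵐ ω ∂P, ∀ w ∈ W, (F w - P[F w | G]) ω = D w ω :=
    (ae_ball_iff (Finset.countable_toSet W)).2 hDeq
  have hI : ∫ ω, ((∑ w ∈ W, F w ω) - P[fun ω => ∑ w ∈ W, F w ω | G] ω) ^ 2 ∂P =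
      ∑ w ∈ W, ∑ v ∈ W, ∫ ω, D w ω * D v ω ∂P := by
    have hint : ∀ w ∈ W, ∀ v ∈ W, Integrable (fun ω => D w ω * D v ω) P := fun w hw v hv =>
      (hD2 w hw).integrable_mul (hD2 v hv)
    have : ∑ w ∈ W, ∑ v ∈ W, ∫ ω, D w ω * D v ω ∂P =
        ∫ ω, ∑ w ∈ W, ∑ v ∈ W, D w ω * D v ω ∂P := by
      rw [integral_finsetSum _ fun w hw => integrable_finsetSum _ fun v hv => hint w hw v hv]
      exact Finset.sum_congr rfl fun w hw => (integral_finsetSum _ (hint w hw)).symm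
    rw [this]
    refine integral_congr_ae ?_
    filter_upwards [hce, hall] with ω h1 h2
    rw [h1, Finset.sum_apply, ← Finset.sum_sub_distrib, sq, Finset.sum_mul_sum]
    exact Finset.sum_congr rfl fun w hw => Finset.sum_congr rfl fun v hv => by
      rw [← h2 w hw, ← h2 v hv]; rfl
  rw [hI, Finset.mul_sum]
  refine Finset.sum_le_sum fun w hw => ?_
  rw [Finset.sum_eq_single_of_mem w hw fun v hv hne => hcov w hw v hv hne]
  exact hsq w hw

end CondVariance

end GeomCLT
end

/-! ### Moment bounds for scores and their truncations -/

noncomputable section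

namespace GeomCLT

attribute [local instance] configSigma

variable {d : ℕ} {Ω : Type*} [MeasurableSpace Ω]

theorem memLp_two_and_variance_le {P : Measure Ω} [IsProbabilityMeasure P] {X : Ω → ℝ}
    (hX : Measurable X) {b : ℝ} (hb : 0 ≤ b)
    (h : ∫⁻ ω, ENNReal.ofReal |X ω| ^ 2 ∂P ≤ ENNReal.ofReal b) :
    MemLp X 2 P ∧ variance X P ≤ b := by
  have h1 : ∀ ω, ENNReal.ofReal |X ω| ^ 2 = ENNReal.ofReal (X ω ^ 2) := by
    intro ω
    rw [← ENNReal.ofReal_pow (abs_nonneg _), sq_abs]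
  simp only [h1] at h
  have hint : Integrable (fun ω => X ω ^ 2) P := by
    refine ⟨(hX.pow_const 2).aestronglyMeasurable, ?_⟩
    rw [hasFiniteIntegral_iff_ofReal (ae_of_all _ fun ω => sq_nonneg _)]
    exact h.trans_lt ENNReal.ofReal_lt_top
  have hL : MemLp X 2 P := (memLp_two_iff_integrable_sq hX.aestronglyMeasurable).2 hint
  refine ⟨hL, (variance_le_expectation_sq hX.aestronglyMeasurable).trans ?_⟩
  simp only [Pi.pow_apply]
  rw [integral_eq_lintegral_of_nonneg_ae (ae_of_all _ fun ω => sq_nonneg _)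
    (hX.pow_const 2).aestronglyMeasurable]
  exact ENNReal.toReal_le_of_le_ofReal hb h

/-- The configurations at which the rescaled functional at `x` is not determined by the points in
the ball of radius `s`. -/
def unstable (ξ : (Fin d → ℝ) → Config d → ℝ≥0) (lam s : ℝ) (x : Fin d → ℝ) : Set (Config d) :=
  {X | scaled ξ lam x X ≠ scaled ξ lam x (restr X (euclBall x s))}

theorem self_mem_euclBall (x : Fin d → ℝ) {s : ℝ} (hs : 0 ≤ s) : x ∈ euclBall x s := by
  change ‖WithLp.toLp 2 (x - x)‖ ≤ s
  simpa using hs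

theorem restr_insert_of_mem {x : Fin d → ℝ} {B : Set (Fin d → ℝ)} (hx : x ∈ B) (X : Config d) :
    restr (insert x X) B = insert x (restr X B) := by
  ext y
  simp only [mem_restr, Finset.mem_insert]
  constructor
  · tauto
  · rintro (rfl | h)
    · exact ⟨Or.inl rfl, hx⟩
    · exact ⟨Or.inr h.1, h.2⟩

theorem measurable_scaled_restr {α : Type*} [MeasurableSpace α]
    {ξ : (Fin d → ℝ) → Config d → ℝ≥0} (hξ : MeasurableFunctional ξ)
    {lam : ℝ} (hlam : 0 < lam) (s : ℝ) {u : α → (Fin d → ℝ)} (hu : Measurable u) {N : α → Config d}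
    (hN : Measurable N) :
    Measurable fun a => scaled ξ lam (u a) (restr (N a) (euclBall (u a) s)) := by
  refine measurable_scaled hξ hlam hu ?_
  have : Measurable fun z : α × (Fin d → ℝ) => (u z.1, z.2) :=
    (hu.comp measurable_fst).prodMk measurable_snd
  exact measurable_restr hN (this (isClosed_euclBall_prod s).measurableSet)

namespace IsPoissonProcess

variable {N : Ω → Config d} {m : Measure (Fin d → ℝ)} {P : Measure Ω}
variable [IsProbabilityMeasure P] [NullSingletonClass m]

/-- Moment bound for sums over the points of a Borel set of a function that is controlled by the
rescaled functional and by instability. -/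
theorem memLp_sum_restr (hN : IsPoissonProcess N m P) {ξ : (Fin d → ℝ) → Config d → ℝ≥0}
    (hξ : MeasurableFunctional ξ) {lam : ℝ} (hlam : 0 < lam) {D : Set (Fin d → ℝ)}
    (hD : MeasurableSet D) {M : ℝ} (hM0 : 0 ≤ M) (hM : m D ≤ ENNReal.ofReal M)
    {p q : ℝ} (hq0 : 0 < q) (hqp : q < p) {Cp : ℝ} (hCp0 : 0 ≤ Cp)
    (hCp : ∀ x ∈ D, ∫⁻ ω, (scaled ξ lam x (N ω) : ℝ≥0∞) ^ p ∂P ≤ ENNReal.ofReal Cp)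
    {s ε : ℝ} (hε0 : 0 ≤ ε)
    (hε : ∀ x ∈ D, P {ω | N ω ∈ unstable ξ lam s x} ≤ ENNReal.ofReal ε)
    {k : ℕ} (hk : p / (p - q) ≤ k) (hk2 : 2 ≤ k)
    {g : (Fin d → ℝ) → Config d → ℝ} (hg : Measurable (Function.uncurry g))
    {α β γ : ℝ} (hα : 0 ≤ α) (hβ : 0 ≤ β) (hγ : 0 ≤ γ)
    (hb : ∀ x ∈ D, ∀ X, g x (insert x X) ^ 2 ≤
      α + β * (scaled ξ lam x X : ℝ) ^ q + γ * (unstable ξ lam s x).indicator 1 X) :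
    MemLp (fun ω => ∑ x ∈ restr (N ω) D, g x (N ω)) 2 P ∧
    variance (fun ω => ∑ x ∈ restr (N ω) D, g x (N ω)) P ≤
      m.real D * (2 ^ (k * k) * (1 + M) ^ k * (α + β * Cp ^ (q / p) + γ * ε ^ (1 / 2 : ℝ))) := by
  have hp : 0 < p := hq0.trans hqp
  have hfin : m D ≠ ∞ := ((measure_mono (subset_univ _)).trans_lt hN.intensity_finite).ne
  set L : ℝ := 2 ^ (k * k) * (1 + M) ^ k with hL
  have hL0 : 0 ≤ L := by positivity
  have hLe : (2 ^ (k * k) * (1 + ENNReal.ofReal M) ^ k : ℝ≥0∞) = ENNReal.ofReal L := by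
    rw [hL, ENNReal.ofReal_mul (by positivity), ENNReal.ofReal_pow (by positivity),
      ENNReal.ofReal_pow (by positivity), ENNReal.ofReal_add zero_le_one hM0]
    simp
  have hmeas : Measurable fun ω => ∑ x ∈ restr (N ω) D, g x (N ω) :=
    measurable_sum_restr_real hN.measurable hD (g := fun ω x => g x (N ω))
      (hg.comp (measurable_snd.prodMk (hN.measurable.comp measurable_fst)))
  refine memLp_two_and_variance_le hmeas (by positivity) ?_
  have hsum : ∀ ω, ENNReal.ofReal |∑ x ∈ restr (N ω) D, g x (N ω)| ^ 2 ≤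
      (∑ x ∈ restr (N ω) D, ENNReal.ofReal |g x (N ω)|) ^ 2 := by
    intro ω
    rw [← ENNReal.ofReal_sum_of_nonneg fun _ _ => abs_nonneg _]
    gcongr
    exact Finset.abs_sum_le_sum_abs _ _
  refine (lintegral_mono hsum).trans ?_
  have hmD : m D = ENNReal.ofReal (m.real D) := (ENNReal.ofReal_toReal hfin).symm
  rw [ENNReal.ofReal_mul measureReal_nonneg, ← hmD, mul_comm]
  refine hN.lintegral_sum_restr_sq_le hD (g := fun x X => ENNReal.ofReal |g x X|)
    (ENNReal.measurable_ofReal.comp hg.abs) fun x hx => ?_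
  have hn := (hN.measurable_card_restr_ennreal hD).add_const 1
  have hscm : Measurable fun ω => scaled ξ lam x (N ω) :=
    measurable_scaled hξ hlam measurable_const hN.measurable
  have hξm : Measurable fun ω => (scaled ξ lam x (N ω) : ℝ≥0∞) ^ q :=
    hscm.coe_nnreal_ennreal.pow_const q
  have hum : MeasurableSet {ω | N ω ∈ unstable ξ lam s x} :=
    (measurableSet_eq_fun hscm
      (measurable_scaled_restr hξ hlam s measurable_const hN.measurable)).compl
  -- Exponent p/q on ξ^q produces the available p-th moment; the conjugate p/(p-q) falls on the
  -- number of points, whence the condition on k.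
  have hconj : (p / (p - q)).HolderConjugate (p / q) := by
    rw [Real.holderConjugate_iff]
    refine ⟨by rw [one_lt_div (by linarith)]; linarith, ?_⟩
    field_simp
    ring
  have h1 := hN.lintegral_card_add_one_mul_le hD hM hconj hk hξm
  -- For the indicator of instability Cauchy–Schwarz is enough and yields the factor ε^(1/2).
  have h2 := hN.lintegral_card_add_one_mul_le hD hM
    (Real.HolderConjugate.two_two) (by exact_mod_cast hk2) (measurable_one.indicator hum)
  have h3 := hN.lintegral_card_add_one_mul_le hD hM
    (Real.HolderConjugate.two_two) (by exact_mod_cast hk2) (measurable_one (α := ℝ≥0∞) (β := Ω))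
  rw [hLe] at h1 h2 h3
  have h1' : ∫⁻ ω, ((restr (N ω) D).card + 1) * (scaled ξ lam x (N ω) : ℝ≥0∞) ^ q ∂P ≤
      ENNReal.ofReal (L * Cp ^ (q / p)) := by
    refine h1.trans ?_
    rw [ENNReal.ofReal_mul hL0, ← ENNReal.ofReal_rpow_of_nonneg hCp0 (by positivity)]
    simp only [← ENNReal.rpow_mul]
    rw [mul_div_cancel₀ _ hq0.ne', one_div_div]
    gcongr
    exact hCp x hx
  have h2' : ∫⁻ ω, ((restr (N ω) D).card + 1) *
      ({ω | N ω ∈ unstable ξ lam s x}.indicator 1 ω : ℝ≥0∞) ∂P ≤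
      ENNReal.ofReal (L * ε ^ (1 / 2 : ℝ)) := by
    refine h2.trans ?_
    rw [ENNReal.ofReal_mul hL0, ← ENNReal.ofReal_rpow_of_nonneg hε0 (by positivity)]
    have : ∀ ω, ({ω | N ω ∈ unstable ξ lam s x}.indicator 1 ω : ℝ≥0∞) ^ (2 : ℝ) =
        {ω | N ω ∈ unstable ξ lam s x}.indicator 1 ω := by
      intro ω
      by_cases h : ω ∈ {ω | N ω ∈ unstable ξ lam s x} <;> simp [h]
    simp only [this]
    rw [lintegral_indicator_one hum]
    gcongr
    exact hε x hx
  have h3' : ∫⁻ ω, ((restr (N ω) D).card + 1 : ℝ≥0∞) ∂P ≤ ENNReal.ofReal L := by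
    simpa using h3
  have hpt : ∀ ω, ((restr (N ω) D).card + 1) * ENNReal.ofReal |g x (insert x (N ω))| ^ 2 ≤
      ENNReal.ofReal α * ((restr (N ω) D).card + 1) +
      ENNReal.ofReal β * (((restr (N ω) D).card + 1) * (scaled ξ lam x (N ω) : ℝ≥0∞) ^ q) +
      ENNReal.ofReal γ * (((restr (N ω) D).card + 1) *
        ({ω | N ω ∈ unstable ξ lam s x}.indicator 1 ω : ℝ≥0∞)) := by
    intro ω
    have h4 := ENNReal.ofReal_le_ofReal (hb x hx (N ω))
    have hi : (0 : ℝ) ≤ (unstable ξ lam s x).indicator 1 (N ω) :=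
      indicator_nonneg (fun _ _ => zero_le_one) _
    have hi2 : ENNReal.ofReal ((unstable ξ lam s x).indicator 1 (N ω)) =
        {ω | N ω ∈ unstable ξ lam s x}.indicator 1 ω := by
      by_cases h : N ω ∈ unstable ξ lam s x <;> simp [h]
    rw [ENNReal.ofReal_add (by positivity) (by positivity),
      ENNReal.ofReal_add (by positivity) (by positivity), ENNReal.ofReal_mul hβ,
      ENNReal.ofReal_mul hγ, hi2, ← ENNReal.ofReal_rpow_of_nonneg (by positivity) hq0.le,
      ENNReal.ofReal_coe_nnreal] at h4
    rw [← ENNReal.ofReal_pow (abs_nonneg _), sq_abs]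
    calc _ ≤ ((restr (N ω) D).card + 1) * (ENNReal.ofReal α +
          ENNReal.ofReal β * (scaled ξ lam x (N ω) : ℝ≥0∞) ^ q +
          ENNReal.ofReal γ * ({ω | N ω ∈ unstable ξ lam s x}.indicator 1 ω : ℝ≥0∞)) := by gcongr
      _ = _ := by ring
  refine (lintegral_mono hpt).trans ?_
  have hm1 : Measurable fun ω =>
      ((restr (N ω) D).card + 1) * (scaled ξ lam x (N ω) : ℝ≥0∞) ^ q := hn.mul hξm
  have hm2 : Measurable fun ω => ((restr (N ω) D).card + 1) *
      ({ω | N ω ∈ unstable ξ lam s x}.indicator 1 ω : ℝ≥0∞) :=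
    hn.mul (measurable_one.indicator hum)
  rw [lintegral_add_right _ (hm2.const_mul _), lintegral_add_right _ (hm1.const_mul _),
    lintegral_const_mul _ hn, lintegral_const_mul _ hm1, lintegral_const_mul _ hm2]
  calc _ ≤ ENNReal.ofReal α * ENNReal.ofReal L +
        ENNReal.ofReal β * ENNReal.ofReal (L * Cp ^ (q / p))
        + ENNReal.ofReal γ * ENNReal.ofReal (L * ε ^ (1 / 2 : ℝ)) := by gcongr
    _ = _ := by
      rw [← ENNReal.ofReal_mul hα, ← ENNReal.ofReal_mul hβ, ← ENNReal.ofReal_mul hγ,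
        ← ENNReal.ofReal_add (by positivity) (by positivity),
        ← ENNReal.ofReal_add (by positivity) (by positivity)]
      congr 1
      ring

end IsPoissonProcess

/-- The rescaled functional computed from the points in the ball of radius `s`, cut off at `t`. -/
def truncated (ξ : (Fin d → ℝ) → Config d → ℝ≥0) (lam s : ℝ) (t : ℝ≥0) (x : Fin d → ℝ)
    (X : Config d) : ℝ≥0 :=
  min (scaled ξ lam x (restr X (euclBall x s))) t

/-- The Mecke formula evaluates functionals at X with x added, while stability and moments refer to
X. A ball of radius s ≥ 0 contains its centre, so the two agree. -/
theorem truncated_insert (ξ : (Fin d → ℝ) → Config d → ℝ≥0) (lam : ℝ) {s : ℝ} (hs : 0 ≤ s)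
    (t : ℝ≥0) (x : Fin d → ℝ) (X : Config d) :
    truncated ξ lam s t x (insert x X) = truncated ξ lam s t x X := by
  rw [truncated, restr_insert_of_mem (self_mem_euclBall x hs), scaled_insert, truncated]

theorem sq_le_one_add_rpow {a q : ℝ} (ha : 0 ≤ a) (hq : 2 ≤ q) : a ^ 2 ≤ 1 + a ^ q := by
  rcases le_total a 1 with h | h
  · have : a ^ 2 ≤ 1 := pow_le_one₀ ha h
    have := Real.rpow_nonneg ha q
    linarith
  · have := Real.rpow_le_rpow_of_exponent_le h hq
    rw [Real.rpow_two] at this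
    linarith

theorem sq_le_rpow_of_lt {a q t : ℝ} (ht : 0 < t) (hta : t ≤ a) (hq : 2 ≤ q) :
    a ^ 2 ≤ t ^ (2 - q) * a ^ q := by
  have ha : 0 < a := ht.trans_le hta
  have h1 : a ^ (2 - q) ≤ t ^ (2 - q) :=
    Real.rpow_le_rpow_of_nonpos ht hta (by linarith)
  calc a ^ 2 = a ^ (2 - q) * a ^ q := by
        rw [← Real.rpow_add ha, ← Real.rpow_two]; congr 1; ring
    _ ≤ _ := by gcongr

/-- At a stable configuration the difference is the excess of the score a over t, and a² ≤ t^(2-q)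
a^q when a ≥ t. At an unstable one the square is at most max(a, t)², which is covered by one of the
two terms. -/
theorem sub_truncated_sq_le (ξ : (Fin d → ℝ) → Config d → ℝ≥0) (lam s : ℝ) {t : ℝ≥0} (ht : 0 < t)
    {q : ℝ} (hq : 2 ≤ q) (x : Fin d → ℝ) (X : Config d) :
    ((scaled ξ lam x X : ℝ) - truncated ξ lam s t x X) ^ 2 ≤
      0 + (t : ℝ) ^ (2 - q) * (scaled ξ lam x X : ℝ) ^ q +
        (t : ℝ) ^ 2 * (unstable ξ lam s x).indicator 1 X := by
  set a : ℝ := (scaled ξ lam x X : ℝ) with ha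
  have ht' : (0 : ℝ) < t := ht
  have hpos : 0 ≤ (t : ℝ) ^ (2 - q) * a ^ q := by positivity
  have hTt : (truncated ξ lam s t x X : ℝ) ≤ t := by exact_mod_cast min_le_right _ _
  by_cases h : X ∈ unstable ξ lam s x
  · simp only [h, indicator_of_mem, Pi.one_apply]
    rcases le_total (t : ℝ) a with hta | hta
    · have := sq_le_rpow_of_lt ht' hta hq
      nlinarith [sq_nonneg (t : ℝ)]
    · nlinarith
  · have heq : scaled ξ lam x (restr X (euclBall x s)) = scaled ξ lam x X := by
      by_contra h'
      exact h fun h2 => h' h2.symm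
    have hT : (truncated ξ lam s t x X : ℝ) = min a t := by
      rw [truncated, heq, NNReal.coe_min]
    simp only [h, indicator_of_notMem, not_false_eq_true, mul_zero, add_zero, zero_add]
    rw [hT]
    rcases le_total (t : ℝ) a with hta | hta
    · have := sq_le_rpow_of_lt ht' hta hq
      rw [min_eq_right hta]
      nlinarith
    · rw [min_eq_left hta]
      simpa using hpos

/-- Unlike the crude bound t², this grows with t only on the unstable configurations, which have
small probability. -/
theorem truncated_sq_le (ξ : (Fin d → ℝ) → Config d → ℝ≥0) (lam s : ℝ) (t : ℝ≥0)
    {q : ℝ} (hq : 2 ≤ q) (x : Fin d → ℝ) (X : Config d) :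
    (truncated ξ lam s t x X : ℝ) ^ 2 ≤
      1 + 1 * (scaled ξ lam x X : ℝ) ^ q +
        (t : ℝ) ^ 2 * (unstable ξ lam s x).indicator 1 X := by
  set a : ℝ := (scaled ξ lam x X : ℝ) with ha
  have ha0 : 0 ≤ a := NNReal.coe_nonneg _
  have hTt : (truncated ξ lam s t x X : ℝ) ≤ t := by exact_mod_cast min_le_right _ _
  have h1 := sq_le_one_add_rpow ha0 hq
  by_cases h : X ∈ unstable ξ lam s x
  · simp only [h, indicator_of_mem, Pi.one_apply]
    nlinarith [Real.rpow_nonneg ha0 q]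
  · have heq : scaled ξ lam x (restr X (euclBall x s)) = scaled ξ lam x X := by
      by_contra h'
      exact h fun h2 => h' h2.symm
    have hT : (truncated ξ lam s t x X : ℝ) ≤ a := by
      rw [truncated, heq, ha]
      exact_mod_cast min_le_left _ _
    simp only [h, indicator_of_notMem, not_false_eq_true, mul_zero, add_zero]
    nlinarith

theorem measurable_truncated {α : Type*} [MeasurableSpace α]
    {ξ : (Fin d → ℝ) → Config d → ℝ≥0} (hξ : MeasurableFunctional ξ)
    {lam : ℝ} (hlam : 0 < lam) (s : ℝ) (t : ℝ≥0) {u : α → (Fin d → ℝ)} (hu : Measurable u)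
    {N : α → Config d} (hN : Measurable N) :
    Measurable fun a => truncated ξ lam s t (u a) (N a) :=
  (measurable_scaled_restr hξ hlam s hu hN).min measurable_const

end GeomCLT
end

noncomputable section

namespace GeomCLT

attribute [local instance] configSigma

variable {d : ℕ} {Ω : Type*} [MeasurableSpace Ω]

/-! ### Blocks -/

/-- The index of the block of side `s` that contains `x`. -/
def blockIndex (s : ℝ) (x : Fin d → ℝ) : Fin d → ℤ := fun i => ⌊x i / s⌋

/-- The half-open cube of side `s` with index `v`. -/
def block (s : ℝ) (v : Fin d → ℤ) : Set (Fin d → ℝ) := {x | blockIndex s x = v}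

/-- The union of the blocks adjacent to the block with index `v`. -/
def blockNhd (s : ℝ) (v : Fin d → ℤ) : Set (Fin d → ℝ) := {x | ∀ i, |blockIndex s x i - v i| ≤ 1}

theorem measurable_blockIndex (s : ℝ) : Measurable (blockIndex s : (Fin d → ℝ) → Fin d → ℤ) :=
  measurable_pi_lambda _ fun i => by
    have : Measurable fun x : Fin d → ℝ => x i / s := by fun_prop
    exact Int.measurable_floor.comp this

theorem measurableSet_block (s : ℝ) (v : Fin d → ℤ) : MeasurableSet (block s v) :=
  measurable_blockIndex s (measurableSet_singleton v)

theorem measurableSet_blockNhd (s : ℝ) (v : Fin d → ℤ) : MeasurableSet (blockNhd s v) :=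
  measurable_blockIndex s (t := {u | ∀ i, |u i - v i| ≤ 1}) (Set.to_countable _).measurableSet

theorem volume_block_le {s : ℝ} (hs : 0 < s) (v : Fin d → ℤ) :
    volume (block s v) ≤ ENNReal.ofReal (s ^ d) := by
  have hsub : block s v ⊆ Set.pi univ fun i => Ico (v i * s) ((v i + 1) * s) := by
    rintro x rfl i -
    refine ⟨?_, ?_⟩
    · have := Int.floor_le (x i / s)
      rw [le_div_iff₀ hs] at this
      exact this
    · have := Int.lt_floor_add_one (x i / s)
      rw [div_lt_iff₀ hs] at this
      exact this
  refine (measure_mono hsub).trans ?_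
  rw [Real.volume_pi_Ico]
  have : ∀ i, ((v i : ℝ) + 1) * s - v i * s = s := fun i => by ring
  simp only [this, Finset.prod_const, Finset.card_univ, Fintype.card_fin]
  rw [ENNReal.ofReal_pow hs.le]

/-- Hence the truncated score at a point of a block depends only on the points in adjacent blocks.
-/
theorem euclBall_subset_blockNhd {s : ℝ} (hs : 0 < s) {v : Fin d → ℤ} {x : Fin d → ℝ}
    (hx : x ∈ block s v) : euclBall x s ⊆ blockNhd s v := by
  obtain rfl : blockIndex s x = v := hx
  intro y hy i
  have h1 : |y i - x i| ≤ s := by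
    have h2 := PiLp.norm_apply_le (WithLp.toLp 2 (y - x)) i
    have h3 : ‖WithLp.toLp 2 (y - x)‖ ≤ s := hy
    exact h2.trans h3
  rw [abs_le] at h1 ⊢
  have e1 : y i / s ≤ x i / s + 1 := by
    rw [div_add_one hs.ne']
    gcongr
    linarith
  have e2 : x i / s ≤ y i / s + 1 := by
    rw [div_add_one hs.ne']
    gcongr
    linarith
  have f1 := Int.floor_mono e1
  have f2 := Int.floor_mono e2
  rw [Int.floor_add_one] at f1 f2
  simp only [blockIndex]
  constructor <;> linarith

/-- The neighbourhoods of the blocks with indices `u` and `v` may meet. -/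
def BlocksNear (u v : Fin d → ℤ) : Prop := ∀ i, |u i - v i| ≤ 2

theorem disjoint_blockNhd (s : ℝ) {u v : Fin d → ℤ} (h : ¬ BlocksNear u v) :
    Disjoint (blockNhd s u : Set (Fin d → ℝ)) (blockNhd s v) := by
  rw [disjoint_left]
  intro x hu hv
  refine h fun i => ?_
  have h1 := hu i
  have h2 := hv i
  rw [abs_le] at h1 h2 ⊢
  constructor <;> linarith

theorem card_filter_near_le (V : Finset (Fin d → ℤ)) (u : Fin d → ℤ)
    [DecidablePred (BlocksNear u)] : (V.filter (BlocksNear u)).card ≤ 5 ^ d := by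
  have hsub : V.filter (BlocksNear u) ⊆
      Finset.Icc (fun i => u i - 2) (fun i => u i + 2) := by
    intro v hv
    have hv' : BlocksNear u v := (Finset.mem_filter.1 hv).2
    rw [Finset.mem_Icc]
    have h : ∀ i, -2 ≤ u i - v i ∧ u i - v i ≤ 2 := fun i => abs_le.1 (hv' i)
    exact ⟨fun i => by simp only; linarith [h i], fun i => by simp only; linarith [h i]⟩
  refine (Finset.card_le_card hsub).trans ?_
  rw [Pi.card_Icc]
  have : ∀ i, (Finset.Icc (u i - 2) (u i + 2)).card = 5 := by
    intro i
    rw [Int.card_Icc, show u i + 2 + 1 - (u i - 2) = 5 by ring]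
    rfl
  simp [this]

theorem finite_blockIndex_image {s : ℝ} (hs : 0 < s) {D : Set (Fin d → ℝ)}
    (hD : Bornology.IsBounded D) : (blockIndex s '' D).Finite := by
  obtain ⟨R, hR⟩ := hD.subset_closedBall 0
  refine (Set.finite_Icc (fun _ : Fin d => ⌊-R / s⌋) (fun _ => ⌊R / s⌋)).subset ?_
  rintro _ ⟨x, hx, rfl⟩
  have h1 : ∀ i, |x i| ≤ R := fun i => by
    have h2 := hR hx
    rw [mem_closedBall_zero_iff] at h2
    exact (norm_le_pi_norm x i).trans h2
  refine ⟨fun i => Int.floor_mono ?_, fun i => Int.floor_mono ?_⟩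
  · have := abs_le.1 (h1 i)
    gcongr
    exact this.1
  · have := abs_le.1 (h1 i)
    gcongr
    exact this.2

theorem restr_restr_of_subset (X : Config d) {B C : Set (Fin d → ℝ)} (h : C ⊆ B) :
    restr (restr X B) C = restr X C := by
  ext x
  simp only [mem_restr]
  constructor
  · tauto
  · rintro ⟨h1, h2⟩
    exact ⟨⟨h1, h h2⟩, h2⟩

theorem variance_add_le_two_mul {P : Measure Ω} [IsProbabilityMeasure P] {X Y : Ω → ℝ}
    (hX : MemLp X 2 P) (hY : MemLp Y 2 P) :
    variance (X + Y) P ≤ 2 * variance X P + 2 * variance Y P := by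
  rw [variance_add hX hY]
  have := covariance_le_half_variance_add hX hY
  linarith

/-! ### Variance of score sums by truncation and blocks -/

namespace IsPoissonProcess

variable {N : Ω → Config d} {m : Measure (Fin d → ℝ)} {P : Measure Ω}
theorem measurable_sum_scaled (hN : IsPoissonProcess N m P) {ξ : (Fin d → ℝ) → Config d → ℝ≥0}
    (hξ : MeasurableFunctional ξ) {lam : ℝ} (hlam : 0 < lam) {D : Set (Fin d → ℝ)}
    (hD : MeasurableSet D) {f : (Fin d → ℝ) → ℝ} (hf : Measurable f) :
    Measurable fun ω => ∑ x ∈ restr (N ω) D, (scaled ξ lam x (N ω) : ℝ) * f x :=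
  measurable_sum_restr_real hN.measurable hD
    (g := fun ω x => (scaled ξ lam x (N ω) : ℝ) * f x)
    ((measurable_scaled hξ hlam measurable_snd
      (hN.measurable.comp measurable_fst)).coe_nnreal_real.mul (hf.comp measurable_snd))

variable [IsProbabilityMeasure P] [NullSingletonClass m]

theorem memLp_sum_scaled (hN : IsPoissonProcess N m P) {ξ : (Fin d → ℝ) → Config d → ℝ≥0}
    (hξ : MeasurableFunctional ξ) {lam : ℝ} (hlam : 0 < lam) {D : Set (Fin d → ℝ)}
    (hD : MeasurableSet D) {p : ℝ} (hp : 2 < p) {Cp : ℝ} (hCp0 : 0 ≤ Cp)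
    (hCp : ∀ x ∈ D, ∫⁻ ω, (scaled ξ lam x (N ω) : ℝ≥0∞) ^ p ∂P ≤ ENNReal.ofReal Cp)
    {f : (Fin d → ℝ) → ℝ} (hf : Measurable f) {K : ℝ} (hfK : ∀ x, |f x| ≤ K) :
    MemLp (fun ω => ∑ x ∈ restr (N ω) D, (scaled ξ lam x (N ω) : ℝ) * f x) 2 P := by
  have hfin : m D ≠ ∞ := ((measure_mono (subset_univ _)).trans_lt hN.intensity_finite).ne
  have hq : (2 : ℝ) < (p + 2) / 2 := by linarith
  -- Here q is the midpoint of 2 and p. With γ = 0 the instability term is absent, so the trivial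
  -- choices s = 0, ε = 1 suffice.
  refine (hN.memLp_sum_restr hξ hlam hD (M := m.real D) measureReal_nonneg
    (ENNReal.ofReal_toReal hfin).ge (q := (p + 2) / 2) (by linarith) (by linarith) hCp0 hCp
    (s := 0) zero_le_one (fun x _ => by simpa using prob_le_one)
    (k := ⌈p / (p - (p + 2) / 2)⌉₊ + 2) ?_ (by simp)
    (g := fun x X => (scaled ξ lam x X : ℝ) * f x) ?_ (α := K ^ 2) (β := K ^ 2) (γ := 0)
    (sq_nonneg _) (sq_nonneg _) le_rfl ?_).1
  · push_cast
    linarith [Nat.le_ceil (p / (p - (p + 2) / 2))]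
  · exact (measurable_scaled hξ hlam measurable_fst measurable_snd).coe_nnreal_real.mul
      (hf.comp measurable_fst)
  · intro x _ X
    rw [scaled_insert, mul_pow, zero_mul, add_zero]
    have h1 := sq_le_one_add_rpow (NNReal.coe_nonneg (scaled ξ lam x X)) hq.le
    have h2 : f x ^ 2 ≤ K ^ 2 := by
      rw [← sq_abs]
      exact pow_le_pow_left₀ (abs_nonneg _) (hfK x) 2
    calc _ ≤ (1 + (scaled ξ lam x X : ℝ) ^ ((p + 2) / 2)) * K ^ 2 := by gcongr
      _ = _ := by ring

/-- Variance bound for sums of a stabilizing functional over the points in a Borel set. -/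
theorem variance_sum_scaled_le (hN : IsPoissonProcess N m P)
    {ξ : (Fin d → ℝ) → Config d → ℝ≥0}
    (hξ : MeasurableFunctional ξ) {lam : ℝ} (hlam : 0 < lam) {D : Set (Fin d → ℝ)}
    (hD : MeasurableSet D) (hDb : Bornology.IsBounded D)
    {M : ℝ} (hM0 : 0 ≤ M) (hM : m D ≤ ENNReal.ofReal M)
    {p q : ℝ} (hq : 2 < q) (hqp : q < p) {Cp : ℝ} (hCp0 : 0 ≤ Cp)
    (hCp : ∀ x ∈ D, ∫⁻ ω, (scaled ξ lam x (N ω) : ℝ≥0∞) ^ p ∂P ≤ ENNReal.ofReal Cp)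
    {s ε : ℝ} (hs : 0 < s) (hε0 : 0 ≤ ε)
    (hε : ∀ x ∈ D, P {ω | N ω ∈ unstable ξ lam s x} ≤ ENNReal.ofReal ε)
    {k : ℕ} (hk : p / (p - q) ≤ k) (hk2 : 2 ≤ k)
    {Mb : ℝ} (hMb0 : 0 ≤ Mb) (hMb : ∀ v, m (block s v) ≤ ENNReal.ofReal Mb)
    {t : ℝ≥0} (ht : 0 < t)
    {f : (Fin d → ℝ) → ℝ} (hf : Measurable f) {K : ℝ} (hfK : ∀ x, |f x| ≤ K) :
    variance (fun ω => ∑ x ∈ restr (N ω) D, (scaled ξ lam x (N ω) : ℝ) * f x) P ≤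
      2 * (m.real D * (2 ^ (k * k) * (1 + M) ^ k * (0 + K ^ 2 * (t : ℝ) ^ (2 - q) * Cp ^ (q / p) +
        K ^ 2 * (t : ℝ) ^ 2 * ε ^ (1 / 2 : ℝ)))) +
      2 * (5 ^ d * (m.real D * (2 ^ (k * k) * (1 + Mb) ^ k * (K ^ 2 + K ^ 2 * Cp ^ (q / p) +
        K ^ 2 * (t : ℝ) ^ 2 * ε ^ (1 / 2 : ℝ))))) := by
  classical
  have hfK2 : ∀ x, f x ^ 2 ≤ K ^ 2 := fun x => by
    rw [← sq_abs]
    exact pow_le_pow_left₀ (abs_nonneg _) (hfK x) 2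
  have hindi : ∀ x X, (0 : ℝ) ≤ (unstable ξ lam s x).indicator 1 X := fun x X =>
    indicator_nonneg (fun _ _ => zero_le_one) _
  have hgt : Measurable (Function.uncurry fun (x : Fin d → ℝ) (X : Config d) =>
      (truncated ξ lam s t x X : ℝ) * f x) :=
    (measurable_truncated hξ hlam s t measurable_fst measurable_snd).coe_nnreal_real.mul
      (hf.comp measurable_fst)
  have hgd : Measurable (Function.uncurry fun (x : Fin d → ℝ) (X : Config d) =>
      ((scaled ξ lam x X : ℝ) - truncated ξ lam s t x X) * f x) :=
    ((measurable_scaled hξ hlam measurable_fst measurable_snd).coe_nnreal_real.sub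
      (measurable_truncated hξ hlam s t measurable_fst measurable_snd).coe_nnreal_real).mul
      (hf.comp measurable_fst)
  -- The truncation error is treated over all of D at once. This costs (1 + M)^k, to be offset by
  -- t^(2-q) and ε^(1/2).
  have hdiff := hN.memLp_sum_restr hξ hlam hD hM0 hM (by linarith) hqp hCp0 hCp hε0 hε hk hk2
    hgd (α := 0) (β := K ^ 2 * (t : ℝ) ^ (2 - q)) (γ := K ^ 2 * (t : ℝ) ^ 2) le_rfl (by positivity)
    (by positivity) (by
      intro x _ X
      rw [scaled_insert, truncated_insert _ _ hs.le, mul_pow]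
      have h1 := sub_truncated_sq_le ξ lam s ht hq.le x X
      have h2 := hindi x X
      calc _ ≤ (0 + (t : ℝ) ^ (2 - q) * (scaled ξ lam x X : ℝ) ^ q +
          (t : ℝ) ^ 2 * (unstable ξ lam s x).indicator 1 X) * K ^ 2 :=
            mul_le_mul h1 (hfK2 x) (sq_nonneg _) ((sq_nonneg _).trans h1)
        _ = _ := by ring)
  -- The truncated part is split into blocks, so the point-count factor involves only the mass Mb of
  -- a single block.
  let Dv : (Fin d → ℤ) → Set (Fin d → ℝ) := fun v => D ∩ block s v
  have hDv : ∀ v, MeasurableSet (Dv v) := fun v => hD.inter (measurableSet_block s v)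
  let Y : (Fin d → ℤ) → Ω → ℝ := fun v ω =>
    ∑ x ∈ restr (N ω) (Dv v), (truncated ξ lam s t x (N ω) : ℝ) * f x
  have hYv : ∀ v, MemLp (Y v) 2 P ∧ variance (Y v) P ≤ m.real (Dv v) *
      (2 ^ (k * k) * (1 + Mb) ^ k * (K ^ 2 + K ^ 2 * Cp ^ (q / p) +
        K ^ 2 * (t : ℝ) ^ 2 * ε ^ (1 / 2 : ℝ))) := fun v =>
    hN.memLp_sum_restr hξ hlam (hDv v) hMb0 ((measure_mono inter_subset_right).trans (hMb v))
      (by linarith) hqp hCp0 (fun x hx => hCp x hx.1) hε0 (fun x hx => hε x hx.1) hk hk2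
      hgt (sq_nonneg _) (sq_nonneg _) (by positivity) (by
        intro x _ X
        rw [truncated_insert _ _ hs.le, mul_pow]
        have h1 := truncated_sq_le ξ lam s t hq.le x X
        have h2 := hindi x X
        calc _ ≤ (1 + 1 * (scaled ξ lam x X : ℝ) ^ q +
            (t : ℝ) ^ 2 * (unstable ξ lam s x).indicator 1 X) * K ^ 2 :=
            mul_le_mul h1 (hfK2 x) (sq_nonneg _) ((sq_nonneg _).trans h1)
          _ = _ := by ring)
  set V : Finset (Fin d → ℤ) := (finite_blockIndex_image hs hDb).toFinset with hV
  have hmem : ∀ x ∈ D, blockIndex s x ∈ V := fun x hx => by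
    rw [hV, Set.Finite.mem_toFinset]; exact ⟨x, hx, rfl⟩
  -- Each Y w is a function of the process restricted to the neighbourhood of its block; for blocks
  -- that are not near, these restrictions are independent.
  have hYcov : ∀ u ∈ V, ∀ v ∈ V, ¬ BlocksNear u v → covariance (Y u) (Y v) P = 0 := by
    intro u _ v _ huv
    have hfac : ∀ w, Y w = (fun X : Config d =>
        ∑ x ∈ restr X (Dv w), (truncated ξ lam s t x X : ℝ) * f x) ∘
        fun ω => restr (N ω) (blockNhd s w) := by
      intro w
      funext ω
      have hsubs : Dv w ⊆ blockNhd s w := fun x hx =>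
        euclBall_subset_blockNhd hs hx.2 (self_mem_euclBall x hs.le)
      simp only [Y, Function.comp_apply, restr_restr_of_subset _ hsubs]
      refine Finset.sum_congr rfl fun x hx => ?_
      rw [truncated, truncated, restr_restr_of_subset _
        (euclBall_subset_blockNhd hs (mem_restr.1 hx).2.2)]
    have hΦ : ∀ w, Measurable fun X : Config d =>
        ∑ x ∈ restr X (Dv w), (truncated ξ lam s t x X : ℝ) * f x := fun w =>
      measurable_sum_restr_real measurable_id (hDv w)
        (g := fun (X : Config d) x => (truncated ξ lam s t x X : ℝ) * f x)
        (hgt.comp measurable_swap)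
    have hind := hN.indepFun_restr (measurableSet_blockNhd s u) (measurableSet_blockNhd s v)
      (disjoint_blockNhd s huv)
    refine IndepFun.covariance_eq_zero ?_ (hYv u).1 (hYv v).1
    rw [hfac u, hfac v]
    exact hind.comp (hΦ u) (hΦ v)
  have hYsum := variance_sum_le_of_local V BlocksNear
    (fun u v h i => by rw [abs_sub_comm]; exact h i) (5 ^ d)
    (fun u _ => card_filter_near_le V u) (fun v _ => (hYv v).1) hYcov
  -- Because the block bounds carry the factor m(D ∩ block), their sum is proportional to the mass
  -- of D and not to the number of blocks.
  have hmsum : ∑ v ∈ V, m.real (Dv v) = m.real D := by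
    have : IsFiniteMeasure m := ⟨hN.intensity_finite⟩
    have hdisj : Set.PairwiseDisjoint (V : Set (Fin d → ℤ)) Dv := fun u _ v _ huv =>
      disjoint_left.2 fun x hx hx' => huv ((hx.2 : blockIndex s x = u).symm.trans hx'.2)
    rw [← measureReal_biUnion_finset hdisj (fun v _ => hDv v)]
    congr 1
    ext x
    simp only [mem_iUnion, exists_prop]
    constructor
    · rintro ⟨v, -, hx⟩
      exact hx.1
    · intro hx
      exact ⟨_, hmem x hx, hx, rfl⟩
  have hYL : MemLp (∑ v ∈ V, Y v) 2 P := by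
    have := memLp_finsetSum V (fun v _ => (hYv v).1)
    convert this using 1
    ext ω
    simp
  have hdec : (fun ω => ∑ x ∈ restr (N ω) D, (scaled ξ lam x (N ω) : ℝ) * f x) =
      (fun ω => ∑ x ∈ restr (N ω) D,
        ((scaled ξ lam x (N ω) : ℝ) - truncated ξ lam s t x (N ω)) * f x) + ∑ v ∈ V, Y v := by
    funext ω
    have h1 : (∑ v ∈ V, Y v) ω =
        ∑ x ∈ restr (N ω) D, (truncated ξ lam s t x (N ω) : ℝ) * f x := by
      rw [Finset.sum_apply, ← Finset.sum_fiberwise_of_maps_to (g := blockIndex s) (t := V)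
        fun x hx => hmem x (mem_restr.1 hx).2]
      refine Finset.sum_congr rfl fun v _ => ?_
      refine Finset.sum_congr ?_ fun _ _ => rfl
      ext x
      simp only [mem_restr, Finset.mem_filter, Dv, mem_inter_iff, and_assoc]
      rfl
    rw [Pi.add_apply, h1, ← Finset.sum_add_distrib]
    exact Finset.sum_congr rfl fun x _ => by ring
  rw [hdec]
  refine (variance_add_le_two_mul hdiff.1 hYL).trans ?_
  refine add_le_add (mul_le_mul_of_nonneg_left hdiff.2 zero_le_two)
    (mul_le_mul_of_nonneg_left (hYsum.trans ?_) zero_le_two)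
  push_cast
  refine mul_le_mul_of_nonneg_left ?_ (by positivity)
  refine (Finset.sum_le_sum fun v _ => (hYv v).2).trans ?_
  rw [← Finset.sum_mul, hmsum]

end IsPoissonProcess

end GeomCLT
end

noncomputable section

namespace GeomCLT

attribute [local instance] configSigma

variable {d : ℕ} {Ω : Type*} [MeasurableSpace Ω]

/-! ### Intensity -/

theorem nullSingletonClass_intensity (hd : 1 ≤ d) (φ : (Fin d → ℝ) → ℝ≥0∞) :
    NullSingletonClass ((volume : Measure (Fin d → ℝ)).withDensity φ) := by
  have : Nonempty (Fin d) := ⟨⟨0, hd⟩⟩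
  have : NullSingletonClass (volume : Measure (Fin d → ℝ)) := by
    rw [volume_pi]; infer_instance
  infer_instance

theorem withDensity_le_mul {φ : (Fin d → ℝ) → ℝ≥0∞} {b : ℝ≥0∞} (hφ : ∀ x, φ x ≤ b)
    {D : Set (Fin d → ℝ)} (hD : MeasurableSet D) :
    (volume : Measure (Fin d → ℝ)).withDensity φ D ≤ b * volume D := by
  rw [withDensity_apply _ hD, ← setLIntegral_const]
  exact lintegral_mono fun x => hφ x

/-! ### Tails of the stabilization radius -/

theorem ExpStabilizing.exists_tail {ξ : (Fin d → ℝ) → Config d → ℝ≥0}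
    {A : Set (Fin d → ℝ)} {N : ℝ → Ω → Config d} {P : Measure Ω}
    (h : ExpStabilizing ξ A N P) :
    ∃ R : ℝ → (Fin d → ℝ) → Ω → ℝ,
      (∀ lam : ℝ, 1 ≤ lam → ∀ x ∈ A, ∀ᵐ ω ∂P, ∀ X : Config d,
        (X : Set (Fin d → ℝ)) ⊆ A \ euclBall x ((scale d lam)⁻¹ * R lam x ω) →
        scaled ξ lam x (restr (N lam ω) (euclBall x ((scale d lam)⁻¹ * R lam x ω)) ∪ X) =
          scaled ξ lam x (restr (N lam ω) (euclBall x ((scale d lam)⁻¹ * R lam x ω)))) ∧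
      ∃ c : ℝ, 0 < c ∧ ∀ᶠ t : ℝ in atTop, ∀ lam : ℝ, 1 ≤ lam → ∀ x ∈ A,
        P {ω | t < R lam x ω} ≤ ENNReal.ofReal (Real.exp (-c * t)) := by
  obtain ⟨R, hR, hlim⟩ := h
  refine ⟨R, fun lam hlam x hx => (hR lam hlam x hx).2, ?_⟩
  -- Any real b strictly between the limsup and 0 gives the tail exp(b t) for large t, so c = -b.
  obtain ⟨b, hb1, hb2⟩ := EReal.lt_iff_exists_real_btwn.1 hlim
  have hb0 : b < 0 := by exact_mod_cast hb2
  refine ⟨-b, by linarith, ?_⟩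
  filter_upwards [eventually_lt_of_limsup_lt hb1, eventually_gt_atTop 0] with t ht ht0
  intro lam hlam x hx
  rw [EReal.div_lt_iff (by exact_mod_cast ht0) (EReal.coe_ne_top t)] at ht
  have h1 := EReal.exp_monotone ht.le
  rw [ENNReal.exp_log, ← EReal.coe_mul, EReal.exp_coe] at h1
  rw [neg_neg]
  refine le_trans ?_ h1
  exact le_iSup_of_le lam (le_iSup_of_le hlam (le_iSup_of_le x (le_iSup_of_le hx le_rfl)))

theorem euclBall_mono (x : Fin d → ℝ) {r s : ℝ} (h : r ≤ s) : euclBall x r ⊆ euclBall x s :=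
  fun _ hy => le_trans hy h

/-- If R ≤ r, both the whole configuration and its part in the larger ball arise from the part in
the ball of radius R/σ by adding points of A outside that ball. Stabilization gives all three the
same score. -/
theorem measure_unstable_le {P : Measure Ω} {ξ : (Fin d → ℝ) → Config d → ℝ≥0}
    {A : Set (Fin d → ℝ)} {N : Ω → Config d} {R : Ω → ℝ} {lam : ℝ} (hlam : 0 < lam)
    {x : Fin d → ℝ} (hNA : ∀ᵐ ω ∂P, ∀ y ∈ N ω, y ∈ A)
    (h : ∀ᵐ ω ∂P, ∀ X : Config d,
        (X : Set (Fin d → ℝ)) ⊆ A \ euclBall x ((scale d lam)⁻¹ * R ω) →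
        scaled ξ lam x (restr (N ω) (euclBall x ((scale d lam)⁻¹ * R ω)) ∪ X) =
          scaled ξ lam x (restr (N ω) (euclBall x ((scale d lam)⁻¹ * R ω)))) (r : ℝ) :
    P {ω | N ω ∈ unstable ξ lam ((scale d lam)⁻¹ * r) x} ≤ P {ω | r < R ω} := by
  classical
  refine measure_mono_ae ?_
  filter_upwards [hNA, h] with ω h1 h2 hω
  change r < R ω
  by_contra hr
  push Not at hr
  refine hω ?_
  set B := euclBall x ((scale d lam)⁻¹ * R ω)
  have hBs : B ⊆ euclBall x ((scale d lam)⁻¹ * r) := by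
    refine euclBall_mono x ?_
    have := (inv_pos.2 (scale_pos d hlam)).le
    gcongr
  have key : ∀ C : Set (Fin d → ℝ), B ⊆ C →
      scaled ξ lam x (restr (N ω) C) = scaled ξ lam x (restr (N ω) B) := by
    intro C hC
    rw [← h2 (restr (N ω) (C \ B)) (fun y hy => ?_)]
    · congr 1
      ext y
      simp only [mem_restr, Finset.mem_union, Set.mem_sdiff]
      have := @hC y
      tauto
    · have := mem_restr.1 (Finset.mem_coe.1 hy)
      exact ⟨h1 y this.1, this.2.2⟩
  have hu : restr (N ω) univ = N ω := by ext; simp [mem_restr]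
  have h3 := key univ (subset_univ _)
  rw [hu] at h3
  rw [h3, key _ hBs]

/-! ### Boundary terms are negligible -/

theorem scale_pow (hd : 1 ≤ d) {lam : ℝ} (hlam : 0 ≤ lam) : scale d lam ^ d = lam := by
  rw [scale, ← Real.rpow_natCast, ← Real.rpow_mul hlam, one_div,
    inv_mul_cancel₀ (by positivity), Real.rpow_one]

theorem tendsto_scale (hd : 1 ≤ d) : Tendsto (scale d) atTop atTop :=
  tendsto_rpow_atTop (by positivity)

/-- Growth estimate for the choice of the truncation parameters. -/
theorem eventually_params {c a b θ : ℝ} (hc : 0 < c) (hθ : 0 < θ) :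
    ∀ᶠ σ : ℝ in atTop, σ ^ a * (σ ^ b * (Real.exp (-c * σ ^ θ)) ^ (1 / 2 : ℝ)) ≤ 1 := by
  have h1 := (tendsto_rpow_mul_exp_neg_mul_atTop_nhds_zero ((a + b) / θ) (c / 2)
    (by positivity)).comp (tendsto_rpow_atTop hθ)
  filter_upwards [h1.eventually_le_const zero_lt_one, eventually_gt_atTop 0] with σ h2 hσ
  refine le_trans (le_of_eq ?_) h2
  simp only [Function.comp_apply]
  rw [← Real.rpow_mul hσ.le, mul_div_cancel₀ _ hθ.ne', Real.rpow_add hσ, ← Real.exp_mul,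
    mul_assoc (σ ^ a), show -c * σ ^ θ * (1 / 2) = -(c / 2) * σ ^ θ by ring]

set_option maxHeartbeats 1000000 in
-- The mass of D is O(lam/σ). The parameters are chosen so that the truncation error has a bounded
-- factor and the block part a factor O(σ^(1/2)), leaving O(lam σ^(-1/2)).
theorem eventually_variance_boundary_le (hd : 1 ≤ d) {P : Measure Ω} [IsProbabilityMeasure P]
    {κ : (Fin d → ℝ) → ℝ≥0} {κ₀ : ℝ≥0} (hκ : ∀ x, κ x ≤ κ₀)
    {A : Set (Fin d → ℝ)} (hA : Bornology.IsBounded A) (hAm : MeasurableSet A)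
    (hκA : ∀ x, x ∉ A → κ x = 0) {N : ℝ → Ω → Config d}
    (hN : ∀ lam : ℝ, 0 < lam → IsPoissonProcess (N lam)
      (volume.withDensity (fun x => ENNReal.ofReal lam * (κ x : ℝ≥0∞))) P)
    {ξ : (Fin d → ℝ) → Config d → ℝ≥0} (hξ : MeasurableFunctional ξ)
    (hstab : ExpStabilizing ξ A N P) {p : ℝ} (hp : 2 < p) {Cp : ℝ} (hCp0 : 0 ≤ Cp)
    (hCp : ∀ lam : ℝ, 1 ≤ lam → ∀ x ∈ A,
      ∫⁻ ω, (scaled ξ lam x (N lam ω) : ℝ≥0∞) ^ p ∂P ≤ ENNReal.ofReal Cp)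
    {f : (Fin d → ℝ) → ℝ} (hf : Measurable f) {K : ℝ} (hfK : ∀ x, |f x| ≤ K)
    {D : ℝ → Set (Fin d → ℝ)} (hD : ∀ lam, MeasurableSet (D lam)) (hDA : ∀ lam, D lam ⊆ A)
    {C : ℝ} (hC : 0 ≤ C)
    (hDC : ∀ᶠ lam in atTop, volume (D lam) ≤ ENNReal.ofReal (C * (scale d lam)⁻¹))
    {δ : ℝ} (hδ : 0 < δ) :
    ∀ᶠ lam in atTop, variance (fun ω => ∑ x ∈ restr (N lam ω) (D lam),
      (scaled ξ lam x (N lam ω) : ℝ) * f x) P ≤ δ * lam := by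
  obtain ⟨R, hR, c, hc, htail⟩ := hstab.exists_tail
  set q : ℝ := (p + 2) / 2 with hq
  have hq2 : 2 < q := by rw [hq]; linarith
  have hqp : q < p := by rw [hq]; linarith
  set k : ℕ := ⌈p / (p - q)⌉₊ + 2 with hk
  have hkp : p / (p - q) ≤ k := by
    rw [hk]; push_cast; linarith [Nat.le_ceil (p / (p - q))]
  have hk2 : 2 ≤ k := by omega
  -- For blocks of side σ^(θ-1) the mass is at most κ₀ σ^(θd), whose k-th power is of order σ^(1/2).
  set θ : ℝ := 1 / (2 * (d * k)) with hθ
  have hθ0 : 0 < θ := by positivity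
  -- With t = σ^τ one has t^(2-q) = lam^(-k), which cancels the growth of (1 + M)^k.
  set τ : ℝ := d * k / (q - 2) with hτ
  set C1 : ℝ := Cp ^ (q / p) with hC1
  set B : ℝ := κ₀ * C * 2 ^ (k * k) * (2 * ((1 + κ₀ * C) ^ k * (K ^ 2 * C1 + K ^ 2)) +
    2 * 5 ^ d * ((1 + κ₀) ^ k * (K ^ 2 + K ^ 2 * C1 + K ^ 2))) with hB
  have hsc := tendsto_scale hd
  have hlimB : ∀ᶠ σ : ℝ in atTop, B * σ ^ (-(1 / 2) : ℝ) ≤ δ := by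
    have := (tendsto_rpow_neg_atTop (y := (1 / 2 : ℝ)) (by norm_num)).const_mul B
    rw [mul_zero] at this
    exact this.eventually_le_const hδ
  filter_upwards [eventually_ge_atTop 1, hDC, hsc.eventually (eventually_ge_atTop 1),
    hsc.eventually ((tendsto_rpow_atTop hθ0).eventually htail),
    hsc.eventually (eventually_params (a := d * k) (b := 2 * τ) hc hθ0),
    hsc.eventually hlimB] with lam hlam hvol hσ1 htl hpar hBδ
  have hlam0 : 0 < lam := by linarith
  set σ : ℝ := scale d lam with hσ
  have hσ0 : 0 < σ := by linarith
  have hσd : σ ^ d = lam := scale_pow hd hlam0.le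
  have hns := nullSingletonClass_intensity hd (fun x => ENNReal.ofReal lam * (κ x : ℝ≥0∞))
  have hPN := hN lam hlam0
  set m := (volume : Measure (Fin d → ℝ)).withDensity
    (fun x => ENNReal.ofReal lam * (κ x : ℝ≥0∞)) with hm
  have hmle : ∀ {E : Set (Fin d → ℝ)}, MeasurableSet E → ∀ {v : ℝ}, 
      volume E ≤ ENNReal.ofReal v → m E ≤ ENNReal.ofReal (lam * κ₀ * v) := by
    intro E hE v hv
    have h1 := withDensity_le_mul (φ := fun x => ENNReal.ofReal lam * (κ x : ℝ≥0∞))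
      (b := ENNReal.ofReal lam * κ₀) (fun x => by gcongr; exact_mod_cast hκ x) hE
    refine h1.trans ?_
    rw [ENNReal.ofReal_mul (by positivity), ENNReal.ofReal_mul hlam0.le, ENNReal.ofReal_coe_nnreal]
    gcongr
  have hNA : ∀ᵐ ω ∂P, ∀ y ∈ N lam ω, y ∈ A := by
    have h0 : m Aᶜ = 0 := by
      rw [hm, withDensity_apply _ hAm.compl, setLIntegral_congr_fun hAm.compl
        (g := fun _ => 0) (fun x hx => by simp [hκA x hx])]
      simp
    filter_upwards [hPN.ae_restr_eq_empty hAm.compl h0] with ω hω y hy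
    by_contra hyA
    have : y ∈ restr (N lam ω) Aᶜ := mem_restr.2 ⟨hy, hyA⟩
    rw [hω] at this
    simp at this
  set s : ℝ := σ⁻¹ * σ ^ θ with hs
  have hs0 : 0 < s := by positivity
  have hε : ∀ x ∈ D lam, P {ω | N lam ω ∈ unstable ξ lam s x} ≤
      ENNReal.ofReal (Real.exp (-c * σ ^ θ)) := fun x hx =>
    (measure_unstable_le hlam0 hNA (hR lam hlam x (hDA lam hx)) (σ ^ θ)).trans
      (htl lam hlam x (hDA lam hx))
  have hMD : m (D lam) ≤ ENNReal.ofReal (lam * κ₀ * (C * σ⁻¹)) := hmle (hD lam) hvol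
  have hsd : lam * s ^ d = (σ ^ θ) ^ d := by
    rw [hs, mul_pow, ← hσd, inv_pow, mul_inv_cancel_left₀ (by positivity)]
  have hMb : ∀ v, m (block s v) ≤ ENNReal.ofReal (κ₀ * (σ ^ θ) ^ d) := by
    intro v
    refine (hmle (measurableSet_block s v) (volume_block_le hs0 v)).trans (le_of_eq ?_)
    rw [← hsd]
    congr 1
    ring
  have ht0 : 0 < σ ^ τ := by positivity
  have hmain := hPN.variance_sum_scaled_le hξ hlam0 (hD lam) (hA.subset (hDA lam))
    (M := lam * κ₀ * (C * σ⁻¹)) (by positivity) hMD hq2 hqp hCp0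
    (fun x hx => hCp lam hlam x (hDA lam hx)) hs0 (Real.exp_pos _).le hε hkp hk2
    (Mb := κ₀ * (σ ^ θ) ^ d) (by positivity) hMb (t := (σ ^ τ).toNNReal) (Real.toNNReal_pos.2 ht0)
    hf hfK
  refine hmain.trans ?_
  rw [Real.coe_toNNReal _ ht0.le]
  set E : ℝ := (Real.exp (-c * σ ^ θ)) ^ (1 / 2 : ℝ) with hE
  have ht2 : (σ ^ τ) ^ 2 = σ ^ (2 * τ) := by
    rw [← Real.rpow_natCast, ← Real.rpow_mul hσ0.le]; congr 1; push_cast; ring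
  have htq : (σ ^ τ) ^ (2 - q) = (σ ^ (d * k : ℝ))⁻¹ := by
    rw [← Real.rpow_mul hσ0.le, ← Real.rpow_neg hσ0.le]
    congr 1
    rw [hτ]
    have : q - 2 ≠ 0 := by linarith
    field_simp
    ring
  have hσdk : σ ^ (d * k : ℝ) = lam ^ k := by
    rw [← hσd, ← pow_mul, ← Real.rpow_natCast]; push_cast; rfl
  have hlk : 1 ≤ lam ^ k := one_le_pow₀ hlam
  have hθdk : ((σ ^ θ) ^ d) ^ k = σ ^ (1 / 2 : ℝ) := by
    rw [← pow_mul, ← Real.rpow_natCast, ← Real.rpow_mul hσ0.le]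
    congr 1
    rw [hθ]
    push_cast
    field_simp
  have hθd1 : 1 ≤ (σ ^ θ) ^ d := one_le_pow₀ (Real.one_le_rpow hσ1 hθ0.le)
  have hm1 : m.real (D lam) ≤ lam * κ₀ * (C * σ⁻¹) :=
    ENNReal.toReal_le_of_le_ofReal (by positivity) hMD
  rw [ht2, htq, hσdk]
  rw [hσdk] at hpar
  have hσinv : σ⁻¹ ≤ 1 := inv_le_one_of_one_le₀ hσ1
  have hb1 : (1 + lam * κ₀ * (C * σ⁻¹)) ^ k ≤ (1 + κ₀ * C) ^ k * lam ^ k := by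
    rw [← mul_pow]
    gcongr
    have h1 : lam * κ₀ * (C * σ⁻¹) ≤ lam * κ₀ * (C * 1) := by gcongr
    have h2 : (1 + κ₀ * C) * lam = lam + lam * κ₀ * (C * 1) := by ring
    linarith
  have hb2 : (1 + κ₀ * (σ ^ θ) ^ d) ^ k ≤ (1 + κ₀) ^ k * σ ^ (1 / 2 : ℝ) := by
    rw [← hθdk, ← mul_pow]
    gcongr
    have h2 : (1 + κ₀) * (σ ^ θ) ^ d = (σ ^ θ) ^ d + κ₀ * (σ ^ θ) ^ d := by ring
    linarith
  have hx1 : (1 + κ₀ * C) ^ k * lam ^ k * (0 + K ^ 2 * (lam ^ k)⁻¹ * C1 + K ^ 2 * σ ^ (2 * τ) * E) ≤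
      (1 + κ₀ * C) ^ k * (K ^ 2 * C1 + K ^ 2) := by
    have e : (1 + κ₀ * C) ^ k * lam ^ k *
        (0 + K ^ 2 * (lam ^ k)⁻¹ * C1 + K ^ 2 * σ ^ (2 * τ) * E) =
        (1 + κ₀ * C) ^ k * (K ^ 2 * C1 + K ^ 2 * (lam ^ k * (σ ^ (2 * τ) * E))) := by
      field_simp
      ring
    rw [e]
    gcongr
    exact mul_le_of_le_one_right (sq_nonneg K) hpar
  have hE1 : σ ^ (2 * τ) * E ≤ 1 := by
    refine le_trans ?_ hpar
    exact le_mul_of_one_le_left (by positivity) hlk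
  have hx2 : K ^ 2 + K ^ 2 * C1 + K ^ 2 * σ ^ (2 * τ) * E ≤ K ^ 2 + K ^ 2 * C1 + K ^ 2 := by
    have := mul_le_of_le_one_right (sq_nonneg K) hE1
    rw [mul_assoc (K ^ 2)]
    linarith
  have hσh : 1 ≤ σ ^ (1 / 2 : ℝ) := Real.one_le_rpow hσ1 (by norm_num)
  have hσhalf : σ⁻¹ * σ ^ (1 / 2 : ℝ) = σ ^ (-(1 / 2) : ℝ) := by
    rw [← Real.rpow_neg_one, ← Real.rpow_add hσ0]; norm_num
  set U : ℝ := (1 + κ₀ * C) ^ k * (K ^ 2 * C1 + K ^ 2) with hU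
  set W : ℝ := K ^ 2 + K ^ 2 * C1 + K ^ 2 with hW
  set h : ℝ := σ ^ (1 / 2 : ℝ) with hh
  have hY1 : 2 ^ (k * k) * (1 + lam * κ₀ * (C * σ⁻¹)) ^ k *
      (0 + K ^ 2 * (lam ^ k)⁻¹ * C1 + K ^ 2 * σ ^ (2 * τ) * E) ≤ 2 ^ (k * k) * U := by
    rw [mul_assoc]
    refine mul_le_mul_of_nonneg_left ?_ (by positivity)
    exact (mul_le_mul_of_nonneg_right hb1 (by positivity)).trans hx1
  have hY2 : 2 ^ (k * k) * (1 + κ₀ * (σ ^ θ) ^ d) ^ k *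
      (K ^ 2 + K ^ 2 * C1 + K ^ 2 * σ ^ (2 * τ) * E) ≤ 2 ^ (k * k) * ((1 + κ₀) ^ k * h) * W :=
    mul_le_mul (mul_le_mul_of_nonneg_left hb2 (by positivity)) hx2 (by positivity) (by positivity)
  have hZ0 : 0 ≤ lam * κ₀ * (C * σ⁻¹) := by positivity
  have hZ1 := mul_le_mul hm1 hY1 (by positivity) hZ0
  have hZ2 := mul_le_mul hm1 hY2 (by positivity) hZ0
  -- The error term is weakened by h ≥ 1 so that both terms share the factor σ⁻¹ h = σ^(-1/2).
  have hZ3 : lam * κ₀ * (C * σ⁻¹) * (2 ^ (k * k) * U) ≤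
      lam * κ₀ * (C * σ⁻¹) * (2 ^ (k * k) * U) * h :=
    le_mul_of_one_le_right (by positivity) hσh
  have hZ4 := mul_le_mul_of_nonneg_left hZ2 (show (0 : ℝ) ≤ 5 ^ d by positivity)
  have hfin : B * (σ⁻¹ * h) * lam ≤ δ * lam := by
    rw [hσhalf]
    exact mul_le_mul_of_nonneg_right hBδ hlam0.le
  linarith

end GeomCLT
end

noncomputable section

namespace GeomCLT

variable {d : ℕ} {Ω : Type*}

/-! ### The cubes of the packing -/

/-- The unit cube centred at `w`, scaled down. -/
def scaledCube (lam : ℝ) (w : Fin d → ℤ) : Set (Fin d → ℝ) := (scale d lam)⁻¹ • unitCube w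

theorem mem_scaledCube {lam : ℝ} (hlam : 0 < lam) {w : Fin d → ℤ} {x : Fin d → ℝ} :
    x ∈ scaledCube lam w ↔ ∀ i, |scale d lam * x i - w i| ≤ 1 / 2 := by
  rw [scaledCube, mem_smul_set_iff_inv_smul_mem₀ (inv_ne_zero (scale_pos d hlam).ne'), inv_inv,
    unitCube, Metric.mem_closedBall, dist_pi_le_iff (by norm_num)]
  simp [Real.dist_eq]

theorem measurableSet_scaledCube (lam : ℝ) (w : Fin d → ℤ) :
    MeasurableSet (scaledCube lam w) :=
  Metric.isClosed_closedBall.measurableSet.const_smul₀ _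

theorem volume_scaledCube (hd : 1 ≤ d) {lam : ℝ} (hlam : 0 < lam) (w : Fin d → ℤ) :
    volume (scaledCube lam w) = ENNReal.ofReal lam⁻¹ := by
  rw [scaledCube, Measure.addHaar_smul, unitCube, Real.volume_pi_closedBall _ (by norm_num)]
  have h := scale_pow hd hlam.le
  simp only [Module.finrank_fin_fun, Fintype.card_fin, inv_pow, h]
  rw [abs_of_pos (inv_pos.2 hlam)]
  norm_num

theorem scaledCube_subset {lam : ℝ} (hlam : 0 < lam) {B : Set (Fin d → ℝ)} {w : Fin d → ℤ}
    (hw : w ∈ packing lam B) : scaledCube lam w ⊆ B := by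
  rintro _ ⟨y, hy, rfl⟩
  obtain ⟨z, hz, rfl⟩ := hw hy
  simpa [smul_smul, (scale_pos d hlam).ne'] using hz

theorem finite_packing {lam : ℝ} {B : Set (Fin d → ℝ)} (hB : Bornology.IsBounded B) :
    (packing lam B).Finite := by
  obtain ⟨R, hR⟩ := (hB.smul₀ (scale d lam)).subset_closedBall 0
  refine (Set.finite_Icc (fun _ : Fin d => ⌊-R⌋) (fun _ => ⌈R⌉)).subset fun w hw => ?_
  have h1 : (fun i => (w i : ℝ)) ∈ Metric.closedBall (0 : Fin d → ℝ) R :=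
    hR (hw (Metric.mem_closedBall_self (by norm_num)))
  rw [mem_closedBall_zero_iff] at h1
  have h2 : ∀ i, |(w i : ℝ)| ≤ R := fun i => (norm_le_pi_norm (fun i => (w i : ℝ)) i).trans h1
  refine ⟨fun i => ?_, fun i => ?_⟩
  · have h3 := (abs_le.1 (h2 i)).1
    have h4 := Int.floor_le (-R)
    exact_mod_cast h4.trans h3
  · have h3 := (abs_le.1 (h2 i)).2
    exact_mod_cast h3.trans (Int.le_ceil R)

/-- The cubes are closed and may share faces; two distinct ones meet at most in a hyperplane. -/
theorem volume_scaledCube_inter {lam : ℝ} (hlam : 0 < lam) {w v : Fin d → ℤ} (hwv : w ≠ v) :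
    volume (scaledCube lam w ∩ scaledCube lam v) = 0 := by
  obtain ⟨i, hi⟩ : ∃ i, w i ≠ v i := by
    by_contra h
    push Not at h
    exact hwv (funext h)
  have hσ := scale_pos d hlam
  refine measure_mono_null (t := {x | x i = ((w i : ℝ) + v i) / 2 / scale d lam}) ?_ ?_
  · rintro x ⟨h1, h2⟩
    rw [mem_scaledCube hlam] at h1 h2
    have h3 := abs_le.1 (h1 i)
    have h4 := abs_le.1 (h2 i)
    change x i = _
    rw [eq_div_iff hσ.ne', mul_comm]
    rcases lt_or_gt_of_ne hi with h | h
    · have h5 : (w i : ℝ) + 1 ≤ v i := by exact_mod_cast h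
      linarith
    · have h5 : (v i : ℝ) + 1 ≤ w i := by exact_mod_cast h
      linarith
  · rw [volume_pi]
    exact Measure.pi_hyperplane _ i _

/-- Otherwise the interior of B and the complement of its closure would disconnect the segment. -/
theorem segment_inter_frontier_nonempty {B : Set (Fin d → ℝ)} {x z : Fin d → ℝ} (hx : x ∈ B)
    (hz : z ∉ B) : (segment ℝ x z ∩ frontier B).Nonempty := by
  by_contra h
  rw [not_nonempty_iff_eq_empty] at h
  have hconn : IsPreconnected (segment ℝ x z) := (convex_segment x z).isPreconnected
  have hsub : segment ℝ x z ⊆ interior B ∪ (closure B)ᶜ := by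
    intro y hy
    by_contra hn
    have hfr : y ∈ segment ℝ x z ∩ frontier B := by
      refine ⟨hy, ?_, fun hi => hn (Or.inl hi)⟩
      by_contra hc
      exact hn (Or.inr hc)
    rw [h] at hfr
    exact hfr
  have hxi : x ∈ interior B := by
    rcases hsub (left_mem_segment ℝ x z) with h1 | h1
    · exact h1
    · exact absurd (subset_closure hx) h1
  have hall := hconn.subset_left_of_subset_union isOpen_interior isClosed_closure.isOpen_compl
    (disjoint_left.2 fun y h1 h2 => h2 (interior_subset_closure h1)) hsub
    ⟨x, left_mem_segment ℝ x z, hxi⟩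
  exact hz (interior_subset (hall (right_mem_segment ℝ x z)))

/-- The part of `B` that is not covered by the cubes of the packing. -/
def uncovered (lam : ℝ) (B : Set (Fin d → ℝ)) : Set (Fin d → ℝ) :=
  B \ ⋃ w ∈ packing lam B, scaledCube lam w

theorem measurableSet_uncovered {lam : ℝ} {B : Set (Fin d → ℝ)} (hB : MeasurableSet B) :
    MeasurableSet (uncovered lam B) := by
  exact hB.diff (MeasurableSet.biUnion (Set.to_countable _) fun w _ =>
    measurableSet_scaledCube lam w)

/-- The cube at the lattice point nearest to σx contains σx but is not in the packing, so its scaled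
copy has a point outside B. That point is within 1/σ of x, and the segment between them crosses the
frontier. -/
theorem uncovered_subset_cthickening {lam : ℝ} (hlam : 0 < lam) (B : Set (Fin d → ℝ)) :
    uncovered lam B ⊆ Metric.cthickening (scale d lam)⁻¹ (frontier B) := by
  rintro x ⟨hxB, hx⟩
  have hσ := scale_pos d hlam
  set w : Fin d → ℤ := fun i => round (scale d lam * x i) with hw
  have hxw : x ∈ scaledCube lam w := by
    rw [mem_scaledCube hlam]
    exact fun i => abs_sub_round _
  have hwp : w ∉ packing lam B := fun h => hx (mem_biUnion h hxw)
  obtain ⟨y, hy, hyB⟩ := not_subset.1 hwp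
  have hzB : (scale d lam)⁻¹ • y ∉ B := by
    rw [mem_smul_set_iff_inv_smul_mem₀ hσ.ne'] at hyB
    exact hyB
  have hz : (scale d lam)⁻¹ • y ∈ scaledCube lam w := smul_mem_smul_set hy
  obtain ⟨u, hu, huf⟩ := segment_inter_frontier_nonempty hxB hzB
  refine Metric.mem_cthickening_of_dist_le x u _ _ huf ?_
  have hxz : dist x ((scale d lam)⁻¹ • y) ≤ (scale d lam)⁻¹ := by
    rw [dist_pi_le_iff (inv_nonneg.2 hσ.le)]
    intro i
    rw [mem_scaledCube hlam] at hxw hz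
    have h1 := abs_le.1 (hxw i)
    have h2 := abs_le.1 (hz i)
    rw [Real.dist_eq, ← mul_le_mul_iff_right₀ hσ, mul_inv_cancel₀ hσ.ne', ← abs_of_pos hσ,
      ← abs_mul, abs_of_pos hσ, mul_sub, abs_le]
    constructor <;> linarith
  refine le_trans ?_ hxz
  rw [dist_comm x u, dist_comm x]
  have hball : segment ℝ x ((scale d lam)⁻¹ • y) ⊆
      Metric.closedBall x (dist ((scale d lam)⁻¹ • y) x) :=
    (convex_closedBall x _).segment_subset (Metric.mem_closedBall_self dist_nonneg)
      (Metric.mem_closedBall.2 le_rfl)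
  exact hball hu

theorem RegularBoundary.exists_volume_uncovered_le (hd : 1 ≤ d) {B : Set (Fin d → ℝ)}
    (hB : RegularBoundary B) (hBb : Bornology.IsBounded B) :
    ∃ C : ℝ, 0 < C ∧ ∀ᶠ lam in atTop,
      volume (uncovered lam B) ≤ ENNReal.ofReal (C * (scale d lam)⁻¹) := by
  obtain ⟨C, hC, h⟩ := Asymptotics.IsBigO.exists_pos hB
  rw [Asymptotics.isBigOWith_iff] at h
  refine ⟨C, hC, ?_⟩
  have ht : Tendsto (fun lam => (scale d lam)⁻¹) atTop (𝓝[>] 0) :=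
    tendsto_inv_atTop_nhdsGT_zero.comp (tendsto_scale hd)
  filter_upwards [ht.eventually h, eventually_gt_atTop 0] with lam h1 hlam
  have hσ := inv_pos.2 (scale_pos d hlam)
  rw [Real.norm_of_nonneg measureReal_nonneg, Real.norm_of_nonneg hσ.le] at h1
  refine (measure_mono (uncovered_subset_cthickening hlam B)).trans ?_
  -- Boundedness matters: the real-valued volume in `RegularBoundary` would be 0 for a set of
  -- infinite volume.
  have hfin : volume (Metric.cthickening (scale d lam)⁻¹ (frontier B)) ≠ ∞ :=
    ((hBb.closure.subset frontier_subset_closure).cthickening).measure_lt_top.ne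
  rw [← ENNReal.ofReal_toReal hfin]
  exact ENNReal.ofReal_le_ofReal h1

theorem volume_le_card_packing (hd : 1 ≤ d) {lam : ℝ} (hlam : 0 < lam) {B : Set (Fin d → ℝ)}
    {W : Finset (Fin d → ℤ)} (hW : ∀ w, w ∈ W ↔ w ∈ packing lam B) :
    volume B ≤ W.card * ENNReal.ofReal lam⁻¹ + volume (uncovered lam B) := by
  have hsub : B ⊆ (⋃ w ∈ W, scaledCube lam w) ∪ uncovered lam B := by
    intro x hx
    by_cases h : x ∈ ⋃ w ∈ packing lam B, scaledCube lam w
    · left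
      simpa [hW] using h
    · exact Or.inr ⟨hx, h⟩
  calc volume B ≤ _ := measure_mono hsub
    _ ≤ volume (⋃ w ∈ W, scaledCube lam w) + volume (uncovered lam B) := measure_union_le _ _
    _ ≤ _ := by
      gcongr
      refine (measure_biUnion_finset_le W _).trans ?_
      simp [volume_scaledCube hd hlam]

/-- If no point of `X` lies in two cubes, a sum over `X ∩ B` splits into the sums over the cubes and
the uncovered part. -/
theorem sum_restr_eq_sum_packing {lam : ℝ} (hlam : 0 < lam) {B : Set (Fin d → ℝ)}
    {W : Finset (Fin d → ℤ)} (hW : ∀ w, w ∈ W ↔ w ∈ packing lam B) {X : Config d}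
    (hX : ∀ w ∈ W, ∀ v ∈ W, w ≠ v → ∀ x ∈ X, x ∈ scaledCube lam w → x ∉ scaledCube lam v)
    (g : (Fin d → ℝ) → ℝ) :
    ∑ x ∈ restr X B, g x = (∑ w ∈ W, ∑ x ∈ restr X (scaledCube lam w), g x) +
      ∑ x ∈ restr X (uncovered lam B), g x := by
  classical
  have hdisj : Set.PairwiseDisjoint (W : Set (Fin d → ℤ)) fun w => restr X (scaledCube lam w) := by
    intro w hw v hv hwv
    rw [Function.onFun, Finset.disjoint_left]
    intro x hx hx'
    rw [mem_restr] at hx hx'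
    exact hX w hw v hv hwv x hx.1 hx.2 hx'.2
  rw [← Finset.sum_biUnion hdisj, ← Finset.sum_union]
  · refine Finset.sum_congr ?_ fun _ _ => rfl
    ext x
    simp only [mem_restr, Finset.mem_union, Finset.mem_biUnion]
    constructor
    · rintro ⟨h1, h2⟩
      by_cases h : x ∈ ⋃ w ∈ packing lam B, scaledCube lam w
      · left
        simp only [mem_iUnion, exists_prop, ← hW] at h
        obtain ⟨w, hw, hxw⟩ := h
        exact ⟨w, hw, h1, hxw⟩
      · exact Or.inr ⟨h1, h2, h⟩
    · rintro (⟨w, hw, h1, h2⟩ | ⟨h1, h2⟩)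
      · exact ⟨h1, scaledCube_subset hlam ((hW w).1 hw) h2⟩
      · exact ⟨h1, h2.1⟩
  · rw [Finset.disjoint_left]
    intro x hx hx'
    rw [Finset.mem_biUnion] at hx
    obtain ⟨w, hw, hxw⟩ := hx
    refine (mem_restr.1 hx').2.2 ?_
    exact mem_biUnion ((hW w).1 hw) (mem_restr.1 hxw).2

/-! ### The integral against the empirical measure -/

/-- The extension of f by zero is used because f is controlled on Γ only; the restriction to A is
void since Γ ⊆ A. -/
theorem T_apply (ξ : (Fin d → ℝ) → Config d → ℝ≥0) {A Γ : Set (Fin d → ℝ)} (hΓ : MeasurableSet Γ)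
    (hΓA : Γ ⊆ A) (N : ℝ → Ω → Config d) (f : (Fin d → ℝ) → ℝ) (lam : ℝ) (ω : Ω) :
    T ξ A N Γ f lam ω =
      ∑ x ∈ restr (N lam ω) Γ, (scaled ξ lam x (N lam ω) : ℝ) * Γ.indicator f x := by
  classical
  rw [T, ← integral_indicator hΓ, xiMeasure, integral_finsetSum_measure fun x _ => ?_]
  · have h : ∀ x, ∫ y, Γ.indicator f y ∂((scaled ξ lam x (N lam ω) : ℝ≥0∞) • Measure.dirac x) =
        Γ.indicator (fun x => (scaled ξ lam x (N lam ω) : ℝ) * Γ.indicator f x) x := by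
      intro x
      rw [integral_smul_measure, integral_dirac]
      by_cases hx : x ∈ Γ <;> simp [hx]
    simp only [h]
    rw [← sum_points_restr, restr_restr_of_subset _ hΓA]
  · exact (integrable_dirac (by simp)).smul_measure ENNReal.coe_ne_top

theorem cubeSum_apply (ξ : (Fin d → ℝ) → Config d → ℝ≥0) {Γ : Set (Fin d → ℝ)}
    (N : ℝ → Ω → Config d) (f : (Fin d → ℝ) → ℝ) {lam : ℝ} (hlam : 0 < lam) {w : Fin d → ℤ}
    (hw : w ∈ packing lam Γ) (ω : Ω) :
    cubeSum ξ N f lam w ω =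
      ∑ x ∈ restr (N lam ω) (scaledCube lam w),
        (scaled ξ lam x (N lam ω) : ℝ) * Γ.indicator f x := by
  refine Finset.sum_congr rfl fun x hx => ?_
  rw [indicator_of_mem (scaledCube_subset hlam hw (mem_restr.1 hx).2)]

theorem HasMoment.lintegral_le [MeasurableSpace Ω] {P : Measure Ω}
    {ξ : (Fin d → ℝ) → Config d → ℝ≥0} {A : Set (Fin d → ℝ)} {N : ℝ → Ω → Config d} {p : ℝ}
    (h : HasMoment ξ A N P p) :
    ∃ C : ℝ, 0 ≤ C ∧ ∀ lam : ℝ, 1 ≤ lam → ∀ x ∈ A,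
      ∫⁻ ω, (scaled ξ lam x (N lam ω) : ℝ≥0∞) ^ p ∂P ≤ ENNReal.ofReal C := by
  refine ⟨(⨆ (lam : ℝ) (_ : 1 ≤ lam) (x ∈ A),
    ∫⁻ ω, (scaled ξ lam x (N lam ω) : ℝ≥0∞) ^ p ∂P).toReal, ENNReal.toReal_nonneg,
    fun lam hlam x hx => ?_⟩
  rw [ENNReal.ofReal_toReal (ne_of_lt h)]
  exact le_iSup_of_le lam (le_iSup_of_le hlam (le_iSup_of_le x (le_iSup_of_le hx le_rfl)))

/-! ### The isolating σ-algebra and the lower bound for the variance -/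

theorem isolationSigma_le [mΩ : MeasurableSpace Ω] {W : Set (Fin d → ℤ)} {Ev : (Fin d → ℤ) → Set Ω}
    {F : (Fin d → ℤ) → Ω → ℝ} (hEv : ∀ w ∈ W, MeasurableSet (Ev w))
    (hF : ∀ w ∈ W, Measurable (F w)) : isolationSigma W Ev F ≤ mΩ := by
  refine iSup₂_le fun w hw => sup_le ?_ ?_
  · refine MeasurableSpace.generateFrom_le fun s hs => ?_
    rw [mem_singleton_iff.1 hs]
    exact hEv w hw
  · exact ((hF w hw).indicator (hEv w hw).compl).comap_le

theorem measurableSet_isolationSigma {W : Set (Fin d → ℤ)} (Ev : (Fin d → ℤ) → Set Ω)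
    (F : (Fin d → ℤ) → Ω → ℝ) {w : Fin d → ℤ} (hw : w ∈ W) :
    MeasurableSet[isolationSigma W Ev F] (Ev w) := by
  have h : MeasurableSpace.generateFrom {Ev w} ≤ isolationSigma W Ev F :=
    le_sup_left.trans (le_iSup₂ (f := fun w (_ : w ∈ W) => MeasurableSpace.generateFrom {Ev w} ⊔
      MeasurableSpace.comap ((Ev w)ᶜ.indicator (F w)) inferInstance) w hw)
  exact h _ (MeasurableSpace.measurableSet_generateFrom rfl)

theorem measurable_indicator_isolationSigma {W : Set (Fin d → ℤ)} (Ev : (Fin d → ℤ) → Set Ω)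
    (F : (Fin d → ℤ) → Ω → ℝ) {w : Fin d → ℤ} (hw : w ∈ W) :
    Measurable[isolationSigma W Ev F] ((Ev w)ᶜ.indicator (F w)) := by
  have h : MeasurableSpace.comap ((Ev w)ᶜ.indicator (F w)) inferInstance ≤ isolationSigma W Ev F :=
    le_sup_right.trans (le_iSup₂ (f := fun w (_ : w ∈ W) => MeasurableSpace.generateFrom {Ev w} ⊔
      MeasurableSpace.comap ((Ev w)ᶜ.indicator (F w)) inferInstance) w hw)
  exact measurable_iff_comap_le.2 h

/-- With V the volume of Γ, the cube sum has variance at least ηρV lam/2 and the uncovered sum at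
most ηρV lam/8. From ηρV/2 ≤ 2 Var(T)/lam + 2 ηρV/8 the constant ηρV/8 results. -/
theorem Nondegenerate.exists_le_variance (hd : 1 ≤ d) [MeasurableSpace Ω] {P : Measure Ω}
    [IsProbabilityMeasure P] {κ : (Fin d → ℝ) → ℝ≥0} {κ₀ : ℝ≥0} (hκ : ∀ x, κ x ≤ κ₀)
    {A : Set (Fin d → ℝ)} (hA : IsCompact A) (hκA : ∀ x, x ∉ A → κ x = 0) {N : ℝ → Ω → Config d}
    (hN : ∀ lam : ℝ, 0 < lam → IsPoissonProcess (N lam)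
      (volume.withDensity (fun x => ENNReal.ofReal lam * (κ x : ℝ≥0∞))) P)
    {ξ : (Fin d → ℝ) → Config d → ℝ≥0} (hξ : MeasurableFunctional ξ)
    (hstab : ExpStabilizing ξ A N P) {p : ℝ} (hp : 2 < p) (hmom : HasMoment ξ A N P p)
    {Γ : Set (Fin d → ℝ)} (hΓ : MeasurableSet Γ) (hΓA : Γ ⊆ A) (hΓ0 : volume Γ ≠ 0)
    (hreg : RegularBoundary Γ) {f : (Fin d → ℝ) → ℝ} (hf : Measurable fun x : Γ => f x)
    (hf_bdd : ∃ K : ℝ, ∀ x ∈ Γ, |f x| ≤ K) (hnd : Nondegenerate ξ N P Γ f) :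
    ∃ C : ℝ, 0 < C ∧ ∀ᶠ lam : ℝ in atTop,
      MemLp (T ξ A N Γ f lam) 2 P ∧ C * lam ≤ variance (T ξ A N Γ f lam) P := by
  classical
  obtain ⟨ρ, η, hρ, hη, hnd⟩ := hnd
  obtain ⟨K, hK⟩ := hf_bdd
  obtain ⟨Cp, hCp0, hCp⟩ := hmom.lintegral_le
  have hΓb : Bornology.IsBounded Γ := hA.isBounded.subset hΓA
  obtain ⟨C, hC, hvol⟩ := hreg.exists_volume_uncovered_le hd hΓb
  set f' : (Fin d → ℝ) → ℝ := Γ.indicator f with hf'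
  have hf'm : Measurable f' := by
    refine measurable_of_restrict_of_restrict_compl hΓ ?_ ?_
    · convert hf using 1
      ext x
      simp [f', domRestrict]
    · convert measurable_const (a := (0 : ℝ)) using 1
      ext x
      simp only [f', domRestrict]
      exact indicator_of_notMem x.2 f
  have hf'K : ∀ x, |f' x| ≤ max K 0 := by
    intro x
    by_cases hx : x ∈ Γ
    · simp only [f', hx, indicator_of_mem]
      exact (hK x hx).trans (le_max_left _ _)
    · simp [f', hx]
  set V : ℝ := volume.real Γ with hV
  have hΓfin : volume Γ ≠ ∞ := hΓb.measure_lt_top.ne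
  have hV0 : 0 < V := ENNReal.toReal_pos hΓ0 hΓfin
  have hbd := eventually_variance_boundary_le hd hκ hA.isBounded hA.measurableSet hκA hN hξ hstab
    hp hCp0 hCp hf'm hf'K (D := fun lam => uncovered lam Γ)
    (fun lam => measurableSet_uncovered hΓ) (fun lam => sdiff_subset.trans hΓA) hC.le hvol
    (δ := η * ρ * V / 8) (by positivity)
  -- The uncovered part takes at most half of the volume of Γ, so at least lam V/2 cubes are needed
  -- for the rest.
  have hsmall : ∀ᶠ lam in atTop, C * (scale d lam)⁻¹ ≤ V / 2 := by
    have := (tendsto_inv_atTop_zero.comp (tendsto_scale hd)).const_mul C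
    rw [mul_zero] at this
    exact this.eventually_le_const (by positivity)
  refine ⟨η * ρ * V / 8, by positivity, ?_⟩
  filter_upwards [hnd, hvol, hbd, hsmall, eventually_ge_atTop 1] with lam hnd hvol hbd hsmall hlam
  obtain ⟨Ev, hEv, hvar, hind⟩ := hnd
  have hlam0 : 0 < lam := by linarith
  have hPN := hN lam hlam0
  have hns := nullSingletonClass_intensity hd (fun x => ENNReal.ofReal lam * (κ x : ℝ≥0∞))
  have hS : ∀ D : Set (Fin d → ℝ), MeasurableSet D → D ⊆ A →
      MemLp (fun ω => ∑ x ∈ restr (N lam ω) D, (scaled ξ lam x (N lam ω) : ℝ) * f' x) 2 P :=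
    fun D hD hDA => hPN.memLp_sum_scaled hξ hlam0 hD hp hCp0
      (fun x hx => hCp lam hlam x (hDA hx)) hf'm hf'K
  have hSm : ∀ D : Set (Fin d → ℝ), MeasurableSet D →
      Measurable (fun ω => ∑ x ∈ restr (N lam ω) D, (scaled ξ lam x (N lam ω) : ℝ) * f' x) :=
    fun D hD => hPN.measurable_sum_scaled hξ hlam0 hD hf'm
  set W : Finset (Fin d → ℤ) := (finite_packing (lam := lam) hΓb).toFinset with hWdef
  have hW : ∀ w, w ∈ W ↔ w ∈ packing lam Γ := fun w => by rw [hWdef, Set.Finite.mem_toFinset]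
  have hFeq : ∀ w ∈ packing lam Γ, cubeSum ξ N f lam w = fun ω =>
      ∑ x ∈ restr (N lam ω) (scaledCube lam w), (scaled ξ lam x (N lam ω) : ℝ) * f' x :=
    fun w hw => funext fun ω => cubeSum_apply ξ N f hlam0 hw ω
  have hFm : ∀ w ∈ packing lam Γ, Measurable (cubeSum ξ N f lam w) := fun w hw => by
    rw [hFeq w hw]; exact hSm _ (measurableSet_scaledCube lam w)
  have hF2 : ∀ w ∈ packing lam Γ, MemLp (cubeSum ξ N f lam w) 2 P := fun w hw => by
    rw [hFeq w hw]
    exact hS _ (measurableSet_scaledCube lam w) ((scaledCube_subset hlam0 hw).trans hΓA)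
  have hEvm : ∀ w ∈ packing lam Γ, MeasurableSet (Ev w) := fun w hw =>
    hPN.measurable.comap_le _ (hEv w hw).1
  have hlow := le_variance_sum_of_condVar (isolationSigma_le hEvm hFm) W
    (fun w hw => hFm w ((hW w).1 hw)) (fun w hw => hF2 w ((hW w).1 hw))
    (fun w hw => measurableSet_isolationSigma Ev _ ((hW w).1 hw))
    (fun w hw => measurable_indicator_isolationSigma Ev _ ((hW w).1 hw))
    (fun w hw => hvar w ((hW w).1 hw))
    (fun w hw v hv hwv => hind w ((hW w).1 hw) v ((hW v).1 hv) hwv)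
  have hcard : lam * V / 2 ≤ W.card := by
    have h1 := volume_le_card_packing hd hlam0 hW
    have h2 : volume Γ ≤ ENNReal.ofReal (W.card * lam⁻¹ + C * (scale d lam)⁻¹) := by
      have := scale_pos d hlam0
      rw [ENNReal.ofReal_add (by positivity) (by positivity), ENNReal.ofReal_mul (by positivity),
        ENNReal.ofReal_natCast]
      exact h1.trans (by gcongr)
    have h3 : V ≤ W.card * lam⁻¹ + C * (scale d lam)⁻¹ := by
      have := scale_pos d hlam0
      exact ENNReal.toReal_le_of_le_ofReal (by positivity) h2
    have h4 : V / 2 ≤ W.card * lam⁻¹ := by linarith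
    rw [← div_eq_mul_inv, le_div_iff₀ hlam0] at h4
    linarith
  have hsumρ : W.card * ρ ≤ ∑ w ∈ W, P.real (Ev w) := by
    rw [← nsmul_eq_mul]
    exact Finset.card_nsmul_le_sum _ _ _ fun w hw => (hEv w ((hW w).1 hw)).2
  have hVlow : η * ρ * V / 2 * lam ≤ variance (fun ω => ∑ w ∈ W, cubeSum ξ N f lam w ω) P := by
    refine le_trans ?_ hlow
    calc η * ρ * V / 2 * lam = η * (lam * V / 2 * ρ) := by ring
      _ ≤ η * (W.card * ρ) := by gcongr
      _ ≤ _ := by gcongr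
  have hTeq : T ξ A N Γ f lam = fun ω =>
      ∑ x ∈ restr (N lam ω) Γ, (scaled ξ lam x (N lam ω) : ℝ) * f' x :=
    funext fun ω => T_apply ξ hΓ hΓA N f lam ω
  have hT2 : MemLp (T ξ A N Γ f lam) 2 P := by
    rw [hTeq]; exact hS Γ hΓ hΓA
  refine ⟨hT2, ?_⟩
  have hD2 := hS (uncovered lam Γ) (measurableSet_uncovered hΓ) (sdiff_subset.trans hΓA)
  -- Almost surely no point lies on a common face, so no score is counted in two cubes.
  have hnull : ∀ᵐ ω ∂P, ∀ w ∈ W, ∀ v ∈ W, w ≠ v → ∀ x ∈ N lam ω, x ∈ scaledCube lam w →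
      x ∉ scaledCube lam v := by
    refine (ae_ball_iff (Finset.countable_toSet W)).2 fun w _ =>
      (ae_ball_iff (Finset.countable_toSet W)).2 fun v _ => ?_
    by_cases hwv : w = v
    · exact ae_of_all _ fun ω h => absurd hwv h
    have h0 := withDensity_absolutelyContinuous (volume : Measure (Fin d → ℝ))
      (fun x => ENNReal.ofReal lam * (κ x : ℝ≥0∞)) (volume_scaledCube_inter hlam0 hwv)
    filter_upwards [hPN.ae_restr_eq_empty ((measurableSet_scaledCube lam w).inter
      (measurableSet_scaledCube lam v)) h0] with ω hω _ x hx hxw hxv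
    have : x ∈ restr (N lam ω) (scaledCube lam w ∩ scaledCube lam v) :=
      mem_restr.2 ⟨hx, hxw, hxv⟩
    rw [hω] at this
    simp at this
  have hdec : (fun ω => ∑ w ∈ W, cubeSum ξ N f lam w ω) =ᵐ[P] T ξ A N Γ f lam + -(fun ω =>
      ∑ x ∈ restr (N lam ω) (uncovered lam Γ), (scaled ξ lam x (N lam ω) : ℝ) * f' x) := by
    filter_upwards [hnull] with ω hω
    rw [Pi.add_apply, Pi.neg_apply, T_apply ξ hΓ hΓA N f lam ω,
      sum_restr_eq_sum_packing hlam0 hW hω fun x => (scaled ξ lam x (N lam ω) : ℝ) * f' x,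
      add_neg_cancel_right]
    exact Finset.sum_congr rfl fun w hw => by rw [hFeq w ((hW w).1 hw)]
  have hup := variance_add_le_two_mul hT2 hD2.neg
  rw [← variance_congr hdec, variance_neg] at hup
  linarith

end GeomCLT

end

theorem lemma4p2 {d : ℕ} (hd : 1 ≤ d)
    {Ω : Type*} [MeasurableSpace Ω] (P : Measure Ω) [IsProbabilityMeasure P]
    (κ : (Fin d → ℝ) → ℝ≥0) (hκ : Measurable κ)
    (hκ_prob : ∫⁻ x, (κ x : ℝ≥0∞) = 1) (hκ_bdd : ∃ K : ℝ≥0, ∀ x, κ x ≤ K)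
    (A : Set (Fin d → ℝ)) (hA : IsCompact A) (hκA : ∀ x, x ∉ A → κ x = 0)
    (N : ℝ → Ω → GeomCLT.Config d)
    (hN : ∀ lam : ℝ, 0 < lam → GeomCLT.IsPoissonProcess (N lam)
      (volume.withDensity (fun x => ENNReal.ofReal lam * (κ x : ℝ≥0∞))) P)
    (ξ : (Fin d → ℝ) → GeomCLT.Config d → ℝ≥0) (hξ : GeomCLT.MeasurableFunctional ξ)
    (hstab : GeomCLT.ExpStabilizing ξ A N P)
    (p : ℝ) (hp : 2 < p) (hmom : GeomCLT.HasMoment ξ A N P p)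
    (m : ℕ) (Γ : Fin m → Set (Fin d → ℝ)) (hΓ : ∀ i, MeasurableSet (Γ i))
    (hΓA : ∀ i, Γ i ⊆ A) (hΓ0 : ∀ i, volume (Γ i) ≠ 0)
    (hA2 : ∀ i, GeomCLT.RegularBoundary (Γ i))
    (f : Fin m → (Fin d → ℝ) → ℝ) (hf : ∀ i, Measurable (fun x : Γ i => f i x))
    (hf_bdd : ∀ i, ∃ K : ℝ, ∀ x ∈ Γ i, |f i x| ≤ K) :
    ∀ i, GeomCLT.Nondegenerate ξ N P (Γ i) (f i) →
      ∃ C : ℝ, 0 < C ∧ ∀ᶠ lam : ℝ in atTop,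
        MemLp (GeomCLT.T ξ A N (Γ i) (f i) lam) 2 P ∧
        C * lam ≤ variance (GeomCLT.T ξ A N (Γ i) (f i) lam) P := by
  obtain ⟨κ₀, hκ₀⟩ := hκ_bdd
  exact fun i hnd => hnd.exists_le_variance hd hκ₀ hA hκA hN hξ hstab hp hmom (hΓ i) (hΓA i)
    (hΓ0 i) (hA2 i) (hf i) (hf_bdd i)
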